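/- For a function $v$ on an open subset of $\mathbb{R}^4$ write $v_i,v_{ij}$ for its partial derivatives, and let $$\begin{aligned}F(\nabla^2 v,\nabla v,v)={}&v^2\big[(v_{11}+v_{33})(v_{22}+v_{44})-(v_{12}+v_{34})(v_{21}+v_{43})-(v_{14}-v_{32})(v_{41}-v_{23})\big]\\&+v\big[(v_2^2+v_4^2)(v_{11}+v_{33})+(v_1^2+v_3^2)(v_{22}+v_{44})-(v_1v_2+v_3v_4)(v_{12}+v_{34}+v_{21}+v_{43})\\&\qquad-(v_1v_4-v_2v_3)(v_{14}-v_{32}+v_{41}-v_{23})\big]-1,\end{aligned}$$ a polynomial in the sixteen entries $v_{ij}$ (treated as independent variables), the $v_k$ and $v$. Put $F^{ij}=\partial F/\partial v_{ij}$, evaluated at $(\nabla^2v(x),\nabla v(x),v(x))$. For a symmetric matrix $A$ let $\sigma_k(A)$ be the $k$-th elementary symmetric function of its eigenvalues. **Theorem.** Let $\Omega\subset\mathbb{R}^4$ be a domain and let $v\in C^4(\Omega)$ be a convex solution (that is, $\nabla^2v\ge0$ in $\Omega$) of $F(\nabla^2v,\nabla v,v)=0$ in $\Omega$. For $x\in\Omega$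 set $$\phi(x)=\sigma_3(\nabla^2v(x))+q(\nabla^2v(x)),\qquad q(\nabla^2 v(x))=\begin{cases}\dfrac{\sigma_4(\nabla^2v(x))}{\sigma_3(\nabla^2v(x))}&\text{if }\sigma_3(\nabla^2v(x))>0,\\[1ex]0&\text{if }\sigma_3(\nabla^2v(x))=0.\end{cases}$$ Suppose that the rank of $\nabla^2v$ on $\Omega$ attains its minimum at $x_0\in\Omega$ and that this minimal rank is $2$. Then there are an open neighborhood $\mathcal{O}\subset\Omega$ of $x_0$, on which $\phi$ is of class $C^2$, and a constant $C>0$, such that $$\sum_{i,j=1}^4F^{ij}\phi_{ij}\le C\,(\phi+|\nabla\phi|)\quad\text{at every point of }\mathcal{O}.$$ The constant $C$ does not depend on $\phi$: it can be chosen to depend only on an upper bound $M$ for $|D^kv(x_0)|$, $0\le k\le4$, and a positive lower bound $c$ for $\sigma_2(\nabla^2v(x_0))$ (while $\mathcal O$ may depend on $v$ and $x_0$). -/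

import Mathlib

noncomputable section

namespace ConstRank

/-- Four-dimensional Euclidean space. Indices `1, 2, 3, 4` of the text are `0, 1, 2, 3 : Fin 4`. -/
abbrev E4 : Type := EuclideanSpace ℝ (Fin 4)

/-- The partial derivative `∂f/∂x_i` at `x`. -/
def pd (i : Fin 4) (f : E4 → ℝ) (x : E4) : ℝ :=
  fderiv ℝ f x (EuclideanSpace.single i 1)

/-- The Hessian matrix `(f_{ij}(x))`. -/
def hess (f : E4 → ℝ) (x : E4) : Matrix (Fin 4) (Fin 4) ℝ :=
  Matrix.of fun i j => pd j (pd i f) x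

/-- The operator `F(A, p, z)`, a polynomial in the sixteen independent entries of `A`,
the four entries of `p` and in `z`. -/
def opF (A : Matrix (Fin 4) (Fin 4) ℝ) (p : Fin 4 → ℝ) (z : ℝ) : ℝ :=
  z ^ 2 * ((A 0 0 + A 2 2) * (A 1 1 + A 3 3) - (A 0 1 + A 2 3) * (A 1 0 + A 3 2)
      - (A 0 3 - A 2 1) * (A 3 0 - A 1 2))
    + z * ((p 1 ^ 2 + p 3 ^ 2) * (A 0 0 + A 2 2) + (p 0 ^ 2 + p 2 ^ 2) * (A 1 1 + A 3 3)
      - (p 0 * p 1 + p 2 * p 3) * (A 0 1 + A 2 3 + A 1 0 + A 3 2)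
      - (p 0 * p 3 - p 1 * p 2) * (A 0 3 - A 2 1 + A 3 0 - A 1 2))
    - 1

/-- `F(∇²v, ∇v, v)` at `x`; the equation is `opFAt v x = 0`. -/
def opFAt (v : E4 → ℝ) (x : E4) : ℝ :=
  opF (hess v x) (fun i => pd i v x) (v x)

/-- The coefficient `F^{ij} = ∂F/∂v_{ij}`, evaluated at `(∇²v(x), ∇v(x), v(x))`. -/
def coeffF (v : E4 → ℝ) (x : E4) (i j : Fin 4) : ℝ :=
  deriv (fun t : ℝ => opF (hess v x + t • Matrix.single i j 1) (fun k => pd k v x) (v x)) 0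

/-- `σ_k(A)`: the `k`-th elementary symmetric function of the eigenvalues of the
symmetric matrix `A`, counted with multiplicity. -/
def sigma (k : ℕ) (A : Matrix (Fin 4) (Fin 4) ℝ) : ℝ :=
  A.charpoly.roots.esymm k

/-- The quotient `σ₄ / σ₃` where `σ₃ > 0`, extended by `0`. -/
def quot (A : Matrix (Fin 4) (Fin 4) ℝ) : ℝ :=
  if 0 < sigma 3 A then sigma 4 A / sigma 3 A else 0

/-- The auxiliary function `φ = σ₃(∇²v) + q(∇²v)`. -/
def phi (v : E4 → ℝ) (x : E4) : ℝ :=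
  sigma 3 (hess v x) + quot (hess v x)

end ConstRank

end

/-! The inequality follows from a constant rank theorem: on a small ball about `x₀` the Hessian has
rank at most 2, so `φ` vanishes identically there, the left side is 0 and the right side is
nonnegative, whatever the positive constant.

Structure of the equation. Pair the indices 0, 2 and 1, 3 into two complex coordinates. A symmetric
real `A` then gives a Hermitian 2×2 matrix H, and F = det m - 1 with m = vH + PP*, P being the
complexified gradient. Up to a factor m is the complex Hessian of v²/2, so the equation is of
complex Monge-Ampère type. The linearised coefficients form v·adj(m), and Cayley-Hamilton makes them
elliptic (`coefMat_elliptic`).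

Key estimate. Differentiate the equation twice along a unit eigenvector f of the Hessian, with
eigenvalue λ. The gradient varies to first order by λf and to second order by the derivative of the
form A(f, f), i.e. by ∇λ wherever λ is smooth. Terms in which the gradient varies are therefore O(λ
+ |∇λ|), and the second derivative of F at frozen gradient remains. It is absorbed by letting the
test vector move, f + tT(d) along the direction d: for a T that is a multiple of the identity minus
a complex rank-one map, `frozen_identity` cancels it up to a multiple of the frozen first
derivative, which is itself O(λ). Hence the contraction of the coefficients with the second
variation of A(f, f) is O(λ + |∇λ|) (`contraction_eq`).

Conclusion. Eigenvalues need not be differentiable, so inequalities are stated for quadratics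
touching from below. Testing with f + tT(d) makes the lowest eigenvalue a supersolution, and a Hopf
barrier (`strong_minimum_principle`) spreads its zero (`lowest_eq_zero`). Once it vanishes
identically, the same scheme applies to the sum of the two lowest eigenvalues (`lowestTwo_eq_zero`).
There a pair of fields must stay nearly orthonormal, and the equality case for the null vector
(`hess₁_null`) controls the cross terms. For a positive semidefinite Hessian, vanishing of that sum
means rank at most 2. -/

open Filter Topology

/-! ### Second-order jets in one variable -/

namespace ConstRank

/-- `f` has second-order jet `(a, b, c)` at `0`: value `a`, first derivative `b` and second
derivative `c`. -/
def HasJet (f : ℝ → ℝ) (a b c : ℝ) : Prop :=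
  f 0 = a ∧ ∃ f' : ℝ → ℝ, (∀ᶠ t in 𝓝 0, HasDerivAt f (f' t) t) ∧ f' 0 = b ∧ HasDerivAt f' c 0

namespace HasJet

variable {f g : ℝ → ℝ} {a b c a' b' c' : ℝ}

theorem const (a : ℝ) : HasJet (fun _ => a) a 0 0 :=
  ⟨rfl, fun _ => 0, Eventually.of_forall fun t => hasDerivAt_const t a, rfl, hasDerivAt_const _ _⟩

theorem id : HasJet (fun t => t) 0 1 0 :=
  ⟨rfl, fun _ => 1, Eventually.of_forall fun t => hasDerivAt_id t, rfl, hasDerivAt_const _ _⟩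

theorem add (hf : HasJet f a b c) (hg : HasJet g a' b' c') :
    HasJet (fun t => f t + g t) (a + a') (b + b') (c + c') := by
  obtain ⟨rfl, f', h1, rfl, h2⟩ := hf
  obtain ⟨rfl, g', k1, rfl, k2⟩ := hg
  refine ⟨rfl, fun t => f' t + g' t, ?_, rfl, h2.add k2⟩
  filter_upwards [h1, k1] with t ht kt using ht.add kt

theorem mul (hf : HasJet f a b c) (hg : HasJet g a' b' c') :
    HasJet (fun t => f t * g t) (a * a') (b * a' + a * b') (c * a' + 2 * (b * b') + a * c') := by
  obtain ⟨rfl, f', h1, rfl, h2⟩ := hf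
  obtain ⟨rfl, g', k1, rfl, k2⟩ := hg
  refine ⟨rfl, fun t => f' t * g t + f t * g' t, ?_, rfl, ?_⟩
  · filter_upwards [h1, k1] with t ht kt using ht.mul kt
  · exact ((h2.mul k1.self_of_nhds).add (h1.self_of_nhds.mul k2)).congr_deriv (by ring)

theorem sum {ι : Type*} {s : Finset ι} {f : ι → ℝ → ℝ} {a b c : ι → ℝ}
    (h : ∀ i ∈ s, HasJet (f i) (a i) (b i) (c i)) :
    HasJet (fun t => ∑ i ∈ s, f i t) (∑ i ∈ s, a i) (∑ i ∈ s, b i) (∑ i ∈ s, c i) := by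
  classical
  induction s using Finset.induction_on with
  | empty => simpa using const 0
  | insert i s hi ih =>
    simp only [Finset.sum_insert hi]
    exact (h i (by simp)).add (ih fun j hj => h j (by simp [hj]))

theorem const_mul (r : ℝ) (hf : HasJet f a b c) :
    HasJet (fun t => r * f t) (r * a) (r * b) (r * c) := by
  simpa using (const r).mul hf

theorem neg (hf : HasJet f a b c) : HasJet (fun t => -f t) (-a) (-b) (-c) := by
  simpa using hf.const_mul (-1)

theorem sub (hf : HasJet f a b c) (hg : HasJet g a' b' c') :
    HasJet (fun t => f t - g t) (a - a') (b - b') (c - c') := by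
  simpa [sub_eq_add_neg] using hf.add hg.neg

theorem affine (r s : ℝ) : HasJet (fun t => r + t * s) r s 0 := by
  simpa using (const r).add (id.mul (const s))

theorem congr (hf : HasJet f a b c) (ha : a = a') (hb : b = b') (hc : c = c') :
    HasJet f a' b' c' := by
  subst ha hb hc
  exact hf

theorem congr_fun (hf : HasJet f a b c) (h : g =ᶠ[𝓝 0] f) : HasJet g a b c := by
  obtain ⟨rfl, f', h1, rfl, h2⟩ := hf
  refine ⟨h.self_of_nhds, f', ?_, rfl, h2⟩
  filter_upwards [h1, h.eventually_nhds] with t ht h't using ht.congr_of_eventuallyEq h't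

theorem unique (hf : HasJet f a b c) (hg : HasJet f a' b' c') : a = a' ∧ b = b' ∧ c = c' := by
  obtain ⟨rfl, f', h1, rfl, h2⟩ := hf
  obtain ⟨rfl, g', k1, rfl, k2⟩ := hg
  refine ⟨rfl, h1.self_of_nhds.unique k1.self_of_nhds, ?_⟩
  have : f' =ᶠ[𝓝 0] g' := by
    filter_upwards [h1, k1] with t ht kt using ht.unique kt
  exact h2.unique (k2.congr_of_eventuallyEq this)

theorem eq_zero (hf : HasJet f a b c) (h : ∀ᶠ t in 𝓝 0, f t = 0) : b = 0 ∧ c = 0 :=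
  (hf.unique ((const 0).congr_fun h)).2

/-- Necessary first and second order conditions at a local minimum with value zero. -/
theorem of_nonneg (hf : HasJet f 0 b c) (h : ∀ᶠ t in 𝓝 0, 0 ≤ f t) : b = 0 ∧ 0 ≤ c := by
  obtain ⟨h0, f', h1, rfl, h2⟩ := hf
  have hmin : IsLocalMin f 0 := by
    filter_upwards [h] with t ht
    rwa [h0]
  have hb : f' 0 = 0 := hmin.hasDerivAt_eq_zero h1.self_of_nhds
  refine ⟨hb, ?_⟩
  -- With negative second derivative, 0 would also be a local maximum; then `f` is locally zero and
  -- uniqueness of jets forces `c = 0`.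
  by_contra! hc
  have hd : deriv f =ᶠ[𝓝 0] f' := by
    filter_upwards [h1] with t ht using ht.deriv
  have hdd : deriv (deriv f) 0 = c := (h2.congr_of_eventuallyEq hd).deriv
  have hmax : IsLocalMax f 0 :=
    isLocalMax_of_deriv_deriv_neg (by rw [hdd]; exact hc) (by rw [hd.self_of_nhds, hb])
      h1.self_of_nhds.continuousAt
  have hz : f =ᶠ[𝓝 0] fun _ => 0 := by
    filter_upwards [h, hmax] with t ht h't
    rw [h0] at h't
    exact le_antisymm h't ht
  have : HasJet f 0 0 0 := (const 0).congr_fun hz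
  have key := unique ⟨h0, f', h1, rfl, h2⟩ this
  exact hc.ne key.2.2

end HasJet

/-! ### Partial derivatives and restriction to lines -/

/-- The point `d` of `Fin 4 → ℝ` as a vector of `E4`. -/
abbrev vec (d : Fin 4 → ℝ) : E4 := WithLp.toLp 2 d

theorem fderiv_vec (f : E4 → ℝ) (x : E4) (d : Fin 4 → ℝ) :
    fderiv ℝ f x (vec d) = ∑ k, d k * pd k f x := by
  have : vec d = ∑ k, d k • EuclideanSpace.single k (1 : ℝ) := by
    ext i
    simp [Finset.sum_apply, Pi.single_apply]
  rw [this, map_sum]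
  simp [pd]

variable {Ω : Set E4} {f : E4 → ℝ} {x : E4}

theorem contDiffOn_pd {n m : ℕ} (hΩ : IsOpen Ω) (hf : ContDiffOn ℝ n f Ω) (h : m + 1 ≤ n)
    (k : Fin 4) : ContDiffOn ℝ m (pd k f) Ω := by
  have : ContDiffOn ℝ m (fderiv ℝ f) Ω := hf.fderiv_of_isOpen hΩ (by exact_mod_cast h)
  exact this.clm_apply contDiffOn_const

theorem pd_comm (hΩ : IsOpen Ω) (hf : ContDiffOn ℝ 2 f Ω) (hx : x ∈ Ω) (i j : Fin 4) :
    pd i (pd j f) x = pd j (pd i f) x := by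
  have hat : ContDiffAt ℝ 2 f x := hf.contDiffAt (hΩ.mem_nhds hx)
  have hsym := hat.isSymmSndFDerivAt (by simp)
  have hd : DifferentiableAt ℝ (fderiv ℝ f) x :=
    (hat.fderiv_right (m := 1) (by norm_num)).differentiableAt (by norm_num)
  have key : ∀ i j : Fin 4, pd i (pd j f) x
      = fderiv ℝ (fderiv ℝ f) x (EuclideanSpace.single i 1) (EuclideanSpace.single j 1) := by
    intro i j
    unfold pd
    rw [fderiv_clm_apply hd (by fun_prop)]
    simp
  rw [key, key]
  exact hsym _ _

theorem pd_congr {g : E4 → ℝ} (hΩ : IsOpen Ω) (hx : x ∈ Ω) (h : ∀ y ∈ Ω, f y = g y) (k : Fin 4) :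
    pd k f x = pd k g x := by
  have : f =ᶠ[𝓝 x] g := by
    filter_upwards [hΩ.mem_nhds hx] with y hy using h y hy
  simp [pd, this.fderiv_eq]

theorem eventually_line (hΩ : IsOpen Ω) (hx : x ∈ Ω) (d : Fin 4 → ℝ) :
    ∀ᶠ t in 𝓝 (0 : ℝ), x + t • vec d ∈ Ω := by
  have hc : Continuous fun t : ℝ => x + t • vec d := by fun_prop
  exact hc.continuousAt.eventually (by simpa using hΩ.mem_nhds hx)

theorem hasDerivAt_line {t : ℝ} {d : Fin 4 → ℝ} (hf : DifferentiableAt ℝ f (x + t • vec d)) :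
    HasDerivAt (fun s : ℝ => f (x + s • vec d)) (∑ k, d k * pd k f (x + t • vec d)) t := by
  rw [← fderiv_vec]
  have h1 : HasDerivAt (fun s : ℝ => x + s • vec d) (vec d) t := by
    simpa using ((hasDerivAt_id t).smul_const (vec d)).const_add x
  exact hf.hasFDerivAt.comp_hasDerivAt t h1

theorem hasJet_line (hΩ : IsOpen Ω) (hf : ContDiffOn ℝ 2 f Ω) (hx : x ∈ Ω) (d : Fin 4 → ℝ) :
    HasJet (fun t : ℝ => f (x + t • vec d)) (f x) (∑ k, d k * pd k f x)
      (∑ k, ∑ l, d k * d l * pd l (pd k f) x) := by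
  refine ⟨by simp, fun t => ∑ k, d k * pd k f (x + t • vec d), ?_, by simp, ?_⟩
  · filter_upwards [eventually_line hΩ hx d] with t ht
    exact hasDerivAt_line ((hf.contDiffAt (hΩ.mem_nhds ht)).differentiableAt (by norm_num))
  · have : ∀ k ∈ Finset.univ, HasDerivAt (fun t : ℝ => d k * pd k f (x + t • vec d))
        (∑ l, d k * d l * pd l (pd k f) x) 0 := by
      intro k _
      have hk : ContDiffOn ℝ (1 : ℕ) (pd k f) Ω := contDiffOn_pd (n := 2) hΩ hf le_rfl k
      have h0 : x + (0 : ℝ) • vec d ∈ Ω := by simpa using hx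
      have := (hasDerivAt_line (((hk.contDiffAt (hΩ.mem_nhds h0)).differentiableAt
        (by norm_num)))).const_mul (d k)
      exact this.congr_deriv (by simp [Finset.mul_sum, mul_assoc])
    exact HasDerivAt.fun_sum this

end ConstRank

/-! ### Strong minimum principle -/

namespace ConstRank

theorem inner_eq_sum (x y : E4) : inner ℝ x y = ∑ i, x i * y i := by
  simp [PiLp.inner_apply, mul_comm]

theorem norm_sq_eq_sum (x : E4) : ‖x‖ ^ 2 = ∑ i, x i ^ 2 := by
  simp [EuclideanSpace.norm_sq_eq]

set_option maxHeartbeats 1000000 in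
/-- A strong minimum principle: a nonnegative continuous function which satisfies
`∑ a_ij w_ij ≤ C (w + |∇w|)` in the sense of quadratic polynomials touching it from below
vanishes near each of its zeros. -/
theorem strong_minimum_principle {w : E4 → ℝ} {a : E4 → Matrix (Fin 4) (Fin 4) ℝ} {x₀ : E4}
    {R θ C : ℝ} (hR : 0 < R) (hθ : 0 < θ) (hC : 0 ≤ C)
    (hw : ContinuousOn w (Metric.ball x₀ R)) (hw0 : ∀ y ∈ Metric.ball x₀ R, 0 ≤ w y)
    (hx₀ : w x₀ = 0)
    (hell : ∀ x ∈ Metric.ball x₀ R, ∀ ξ : Fin 4 → ℝ,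
      θ * ∑ i, ξ i ^ 2 ≤ ∑ i, ∑ j, a x i j * (ξ i * ξ j))
    (htr : ∀ x ∈ Metric.ball x₀ R, ∑ i, a x i i ≤ C)
    (hsub : ∀ x ∈ Metric.ball x₀ R, ∀ (b : Fin 4 → ℝ) (Q : Matrix (Fin 4) (Fin 4) ℝ),
      (∀ᶠ y in 𝓝 x, w x + ∑ i, b i * (y i - x i)
        + (1 / 2) * ∑ i, ∑ j, Q i j * ((y i - x i) * (y j - x j)) ≤ w y) →
      ∑ i, ∑ j, a x i j * Q i j ≤ C * (w x + ∑ i, |b i|)) :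
    ∀ y ∈ Metric.ball x₀ (R / 4), w y = 0 := by
  -- Hopf's argument: `z` is a zero of `w` nearest to `y₁`, so `w` is positive on the open ball
  -- about `y₁` through `z`; `ν` is the unit vector from `z` towards `y₁`.
  by_contra! ⟨y₁, hy₁, hwy₁⟩
  have hsubset : Metric.closedBall x₀ (R / 2) ⊆ Metric.ball x₀ R :=
    Metric.closedBall_subset_ball (by linarith)
  have hZcl : IsClosed (Metric.closedBall x₀ (R / 2) ∩ w ⁻¹' {0}) :=
    (hw.mono hsubset).preimage_isClosed_of_isClosed Metric.isClosed_closedBall isClosed_singleton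
  have hZ : IsCompact (Metric.closedBall x₀ (R / 2) ∩ w ⁻¹' {0}) :=
    (isCompact_closedBall x₀ (R / 2)).of_isClosed_subset hZcl Set.inter_subset_left
  have hx₀Z : x₀ ∈ Metric.closedBall x₀ (R / 2) ∩ w ⁻¹' {0} :=
    ⟨Metric.mem_closedBall_self (by linarith), hx₀⟩
  obtain ⟨z, ⟨hzB, hz0⟩, hzmin⟩ := hZ.exists_isMinOn ⟨x₀, hx₀Z⟩
    (f := fun y => dist y y₁) (by fun_prop)
  have hz0 : w z = 0 := hz0
  have hρlt : dist z y₁ < R / 4 :=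
    lt_of_le_of_lt (hzmin hx₀Z) (by simpa [dist_comm] using hy₁)
  have hρ : 0 < dist z y₁ := by
    rw [dist_pos]
    rintro rfl
    exact hwy₁ hz0
  set ρ := dist z y₁ with hρdef
  have hy₁' : dist y₁ x₀ < R / 4 := hy₁
  have hpos : ∀ y, dist y y₁ < ρ → 0 < w y := by
    intro y hy
    have hyB : dist y x₀ ≤ R / 2 := by linarith [dist_triangle y y₁ x₀]
    refine lt_of_le_of_ne (hw0 y (hsubset hyB)) fun h => ?_
    exact absurd (hzmin (show y ∈ _ from ⟨hyB, h.symm⟩)) (by simpa using hy)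
  have hzx₀ : dist z x₀ < R / 2 := by linarith [dist_triangle z y₁ x₀]
  set ν : E4 := ρ⁻¹ • (y₁ - z) with hν
  have hνn : ‖ν‖ = 1 := by
    rw [hν, norm_smul, ← dist_eq_norm, dist_comm, norm_inv, Real.norm_of_nonneg hρ.le]
    exact inv_mul_cancel₀ hρ.ne'
  have hdist : ∀ y, dist y y₁ ^ 2 = ‖y - z‖ ^ 2 - 2 * ρ * inner ℝ (y - z) ν + ρ ^ 2 := by
    intro y
    have : y - y₁ = (y - z) - ρ • ν := by
      rw [hν, smul_inv_smul₀ hρ.ne']; abel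
    rw [dist_eq_norm, this, norm_sub_sq_real, norm_smul, hνn, inner_smul_right,
      Real.norm_of_nonneg hρ.le]
    ring
  set κ := ρ⁻¹ with hκ
  have hκpos : 0 < κ := inv_pos.2 hρ
  -- Chosen for the final comparison: `κ * C` absorbs the trace term, and `2 * 8 * C` beats the
  -- total `C * (1 / 2 + 14)` coming from value and gradient.
  set K := (8 * C + κ * C + 1) / θ with hK
  have hKpos : 0 < K := by positivity
  obtain ⟨η, hη, hη1, hηR, hηK, hηκ⟩ : ∃ η : ℝ, 0 < η ∧ η ≤ 1 / 4 ∧ η ≤ R / 4 ∧ K * η ≤ 1 / 6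
      ∧ κ * η ≤ 1 := by
    refine ⟨min (min (1 / 4) (R / 4)) (min (1 / (6 * K)) (1 / κ)), by positivity, ?_, ?_, ?_, ?_⟩
    · exact (min_le_left _ _).trans (min_le_left _ _)
    · exact (min_le_left _ _).trans (min_le_right _ _)
    · calc K * _ ≤ K * (1 / (6 * K)) := by
            gcongr; exact (min_le_right _ _).trans (min_le_left _ _)
        _ = 1 / 6 := by field_simp
    · calc κ * _ ≤ κ * (1 / κ) := by
            gcongr; exact (min_le_right _ _).trans (min_le_right _ _)
        _ = 1 := by field_simp
  have hDsub : Metric.closedBall z η ⊆ Metric.ball x₀ R := by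
    intro y hy
    have : dist y z ≤ η := hy
    have := dist_triangle y z x₀
    exact Metric.mem_ball.2 (by linarith)
  -- The barrier: it vanishes at `z`, and the large `K` makes it strictly convex along `ν`. The
  -- concave part is tuned by `κ = ρ⁻¹` so that, on the small sphere about `z`, the set where `P` is
  -- nonnegative lies inside the ball about `y₁`.
  set P : E4 → ℝ := fun y => inner ℝ (y - z) ν + K * inner ℝ (y - z) ν ^ 2 - κ * ‖y - z‖ ^ 2
    with hP
  have hPc : Continuous P := by fun_prop
  have hs : ∀ y, ‖y - z‖ ≤ η → |inner ℝ (y - z) ν| ≤ η := by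
    intro y hy
    have := abs_real_inner_le_norm (y - z) ν
    rw [hνn, mul_one] at this
    linarith
  have hPle : ∀ y, ‖y - z‖ ≤ η → P y ≤ 1 / 2 := by
    intro y hy
    have h1 := abs_le.1 (hs y hy)
    have h2 : K * inner ℝ (y - z) ν ^ 2 ≤ K * η * η := by
      have : inner ℝ (y - z) ν ^ 2 ≤ η ^ 2 := by
        rw [sq_le_sq, abs_of_pos hη]; exact hs y hy
      nlinarith
    have h3 : 0 ≤ κ * ‖y - z‖ ^ 2 := by positivity
    have h4 : K * η * η ≤ 1 / 6 * (1 / 4) := by gcongr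
    simp only [hP]
    linarith [h1.2]
  have hS : IsCompact (Metric.sphere z η ∩ P ⁻¹' Set.Ici 0) :=
    (isCompact_sphere z η).inter_right (isClosed_Ici.preimage hPc)
  have hSpos : ∀ y ∈ Metric.sphere z η ∩ P ⁻¹' Set.Ici 0, 0 < w y := by
    rintro y ⟨hy, hPy⟩
    have hyη : ‖y - z‖ = η := by rw [← dist_eq_norm]; exact hy
    have hPy : 0 ≤ P y := hPy
    simp only [hP, hyη] at hPy
    have h1 := abs_le.1 (hs y hyη.le)
    set s : ℝ := inner ℝ (y - z) ν with hsdef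
    have hKs : -(1 / 6) ≤ K * s := by nlinarith [h1.1]
    have hKs' : K * s ≤ 1 / 6 := by nlinarith [h1.2]
    have hkη : 0 < κ * η ^ 2 := by positivity
    have hfac : κ * η ^ 2 ≤ s * (1 + K * s) := by linarith
    have hspos : 0 < s := by
      by_contra! hs0
      nlinarith
    have h2 : κ * η ^ 2 ≤ s * (7 / 6) := by nlinarith
    have h3 : η ^ 2 ≤ ρ * s * (7 / 6) := by
      have : ρ * (κ * η ^ 2) = η ^ 2 := by rw [← mul_assoc, hκ, mul_inv_cancel₀ hρ.ne', one_mul]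
      nlinarith
    -- The squared distance to `y₁` is `η² - 2ρs + ρ²`, which is less than `ρ²` because `η² ≤
    -- (7/6)ρs`.
    apply hpos
    have hd := hdist y
    rw [hyη] at hd
    have : 0 < ρ * s := by positivity
    exact lt_of_pow_lt_pow_left₀ 2 hρ.le (by linarith)
  obtain ⟨δ, hδ, hδw⟩ : ∃ δ > 0, ∀ y ∈ Metric.sphere z η ∩ P ⁻¹' Set.Ici 0, δ ≤ w y := by
    rcases (Metric.sphere z η ∩ P ⁻¹' Set.Ici 0).eq_empty_or_nonempty with h | h
    · exact ⟨1, one_pos, by simp [h]⟩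
    · obtain ⟨m, hm, hmin⟩ := hS.exists_isMinOn h
        (hw.mono ((Set.inter_subset_left.trans Metric.sphere_subset_closedBall).trans hDsub))
      exact ⟨w m, hSpos m hm, fun y hy => hmin hy⟩
  -- At a minimum of `w - δP` the function `w` is touched from below by a quadratic. The minimum
  -- value is at most 0, the value at `z`, so `P x ≥ 0`. This excludes the boundary sphere, where `w
  -- ≥ δ` while `δP ≤ δ/2`.
  obtain ⟨x, hxD, hxmin⟩ := (isCompact_closedBall z η).exists_isMinOn
    ⟨z, Metric.mem_closedBall_self hη.le⟩ (f := fun y => w y - δ * P y)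
    ((hw.mono hDsub).sub (by fun_prop))
  have hxle : w x ≤ δ * P x := by
    have : w x - δ * P x ≤ w z - δ * P z := hxmin (Metric.mem_closedBall_self hη.le)
    have hPz : P z = 0 := by simp [hP]
    rw [hz0, hPz] at this
    linarith
  have hxR := hDsub hxD
  have hxη : ‖x - z‖ ≤ η := by rw [← dist_eq_norm]; exact hxD
  have hPx0 : 0 ≤ P x := by
    by_contra! h
    nlinarith [hw0 x hxR]
  have hxint : x ∈ Metric.ball z η := by
    rcases lt_or_eq_of_le (Metric.mem_closedBall.1 hxD) with h | h
    · exact h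
    · exfalso
      have h1 := hδw x ⟨h, hPx0⟩
      nlinarith [hPle x hxη]
  set s : ℝ := inner ℝ (x - z) ν with hsdef
  have hsum := hsub x hxR (fun i => δ * ((1 + 2 * K * s) * ν i - 2 * κ * (x i - z i)))
    (Matrix.of fun i j => 2 * δ * (K * (ν i * ν j) - κ * (if i = j then 1 else 0))) (by
      filter_upwards [Metric.isOpen_ball.mem_nhds hxint] with y hy
      have hmin : w x - δ * P x ≤ w y - δ * P y := hxmin (Metric.ball_subset_closedBall hy)
      have hexp : P y - P x = (1 + 2 * K * s) * inner ℝ (y - x) ν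
          - 2 * κ * inner ℝ (x - z) (y - x) + K * inner ℝ (y - x) ν ^ 2 - κ * ‖y - x‖ ^ 2 := by
        have hyx : y - z = (x - z) + (y - x) := by abel
        simp only [hP, hsdef]
        rw [hyx, norm_add_sq_real, inner_add_left]
        ring
      have e1 : ∑ i, δ * ((1 + 2 * K * s) * ν i - 2 * κ * (x i - z i)) * (y i - x i)
          = δ * ((1 + 2 * K * s) * inner ℝ (y - x) ν - 2 * κ * inner ℝ (x - z) (y - x)) := by
        rw [inner_eq_sum, inner_eq_sum, mul_sub, Finset.mul_sum, Finset.mul_sum, Finset.mul_sum,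
          Finset.mul_sum, ← Finset.sum_sub_distrib]
        refine Finset.sum_congr rfl fun i _ => ?_
        simp only [PiLp.sub_apply]
        ring
      have e2 : (1 / 2) * ∑ i, ∑ j, (Matrix.of fun i j => 2 * δ * (K * (ν i * ν j)
          - κ * (if i = j then 1 else 0)) : Matrix (Fin 4) (Fin 4) ℝ) i j
            * ((y i - x i) * (y j - x j))
          = δ * (K * inner ℝ (y - x) ν ^ 2 - κ * ‖y - x‖ ^ 2) := by
        rw [inner_eq_sum, norm_sq_eq_sum]
        simp only [Fin.sum_univ_four, Matrix.of_apply, PiLp.sub_apply]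
        simp
        ring
      rw [e1, e2]
      have : δ * P y = δ * P x + δ * (P y - P x) := by ring
      rw [hexp] at this
      linarith)
  have hlow : 2 * δ * (K * θ - κ * C) ≤ ∑ i, ∑ j, a x i j *
      (Matrix.of fun i j => 2 * δ * (K * (ν i * ν j)
          - κ * (if i = j then 1 else 0)) : Matrix (Fin 4) (Fin 4) ℝ) i j := by
    have h1 := hell x hxR ν
    rw [← norm_sq_eq_sum, hνn] at h1
    have h2 := htr x hxR
    have e : ∑ i, ∑ j, a x i j * (Matrix.of fun i j => 2 * δ * (K * (ν i * ν j)
          - κ * (if i = j then 1 else 0)) : Matrix (Fin 4) (Fin 4) ℝ) i j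
        = 2 * δ * (K * (∑ i, ∑ j, a x i j * (ν i * ν j)) - κ * ∑ i, a x i i) := by
      simp only [Fin.sum_univ_four, Matrix.of_apply]
      simp
      ring
    rw [e]
    have h3 : K * θ ≤ K * (∑ i, ∑ j, a x i j * (ν i * ν j)) := by nlinarith
    have h4 : κ * ∑ i, a x i i ≤ κ * C := by gcongr
    have : K * θ - κ * C ≤ K * (∑ i, ∑ j, a x i j * (ν i * ν j)) - κ * ∑ i, a x i i := by linarith
    gcongr
  have hs1 := hs x hxη
  rw [← hsdef] at hs1
  have hbnd : ∀ i, |δ * ((1 + 2 * K * s) * ν i - 2 * κ * (x i - z i))| ≤ δ * (7 / 2) := by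
    intro i
    rw [abs_mul, abs_of_pos hδ]
    gcongr
    have hνi : |ν i| ≤ 1 := by
      have := PiLp.norm_apply_le ν i
      rwa [hνn] at this
    have hxi : |x i - z i| ≤ η := by
      have := PiLp.norm_apply_le (x - z) i
      exact le_trans (by simpa using this) hxη
    have hKs : |1 + 2 * K * s| ≤ 4 / 3 := by
      have := abs_le.1 hs1
      rw [abs_le]
      constructor <;> nlinarith
    calc |(1 + 2 * K * s) * ν i - 2 * κ * (x i - z i)|
        ≤ |(1 + 2 * K * s) * ν i| + |2 * κ * (x i - z i)| := abs_sub _ _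
      _ = |1 + 2 * K * s| * |ν i| + 2 * κ * |x i - z i| := by
          rw [abs_mul, abs_mul, abs_of_pos (by positivity : (0 : ℝ) < 2 * κ)]
      _ ≤ 4 / 3 * 1 + 2 * κ * η := by gcongr
      _ ≤ 7 / 2 := by linarith
  have hup : C * (w x + ∑ i, |δ * ((1 + 2 * K * s) * ν i - 2 * κ * (x i - z i))|)
      ≤ C * (δ * (1 / 2) + δ * 14) := by
    gcongr
    · exact hxle.trans (by gcongr; exact hPle x hxη)
    · calc _ ≤ ∑ _i : Fin 4, δ * (7 / 2) := Finset.sum_le_sum fun i _ => hbnd i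
        _ = δ * 14 := by simp; ring
  have hKθ : K * θ = 8 * C + κ * C + 1 := by rw [hK]; field_simp
  have hfin := (hlow.trans hsum).trans hup
  rw [hKθ] at hfin
  nlinarith [mul_nonneg hδ.le hC]

end ConstRank

/-! ### Complex structure of the operator and the cancellation identity -/

namespace ConstRank

/-- The symmetric coefficient matrix `∂F/∂A_ij` at a symmetric matrix `A`. -/
def coefMat (A : Matrix (Fin 4) (Fin 4) ℝ) (p : Fin 4 → ℝ) (z : ℝ) : Matrix (Fin 4) (Fin 4) ℝ :=
  let m₁ := z * (A 0 0 + A 2 2) + (p 0 ^ 2 + p 2 ^ 2)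
  let m₂ := z * (A 1 1 + A 3 3) + (p 1 ^ 2 + p 3 ^ 2)
  let mr := z * (A 0 1 + A 2 3) + (p 0 * p 1 + p 2 * p 3)
  let mi := z * (A 0 3 - A 2 1) + (p 0 * p 3 - p 1 * p 2)
  !![z * m₂, -(z * mr), 0, -(z * mi);
     -(z * mr), z * m₁, z * mi, 0;
     0, z * mi, z * m₂, -(z * mr);
     -(z * mi), 0, -(z * mr), z * m₁]

/-- The determinant of the complexification of a symmetric matrix. -/
def cdet (A : Matrix (Fin 4) (Fin 4) ℝ) : ℝ :=
  (A 0 0 + A 2 2) * (A 1 1 + A 3 3) - (A 0 1 + A 2 3) ^ 2 - (A 0 3 - A 2 1) ^ 2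

/-- The polarisation of `cdet`. -/
def cdetPolar (A X : Matrix (Fin 4) (Fin 4) ℝ) : ℝ :=
  (A 0 0 + A 2 2) * (X 1 1 + X 3 3) + (A 1 1 + A 3 3) * (X 0 0 + X 2 2)
    - 2 * (A 0 1 + A 2 3) * (X 0 1 + X 2 3) - 2 * (A 0 3 - A 2 1) * (X 0 3 - X 2 1)

/-- The part of `F` that is linear in the Hessian, polarised in the gradient. -/
def gradForm (p r : Fin 4 → ℝ) (A : Matrix (Fin 4) (Fin 4) ℝ) : ℝ :=
  (p 1 * r 1 + p 3 * r 3) * (A 0 0 + A 2 2) + (p 0 * r 0 + p 2 * r 2) * (A 1 1 + A 3 3)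
    - (p 0 * r 1 + p 1 * r 0 + p 2 * r 3 + p 3 * r 2) * (A 0 1 + A 2 3)
    - (p 0 * r 3 + p 3 * r 0 - p 1 * r 2 - p 2 * r 1) * (A 0 3 - A 2 1)

/-- Multiplication by the imaginary unit for the complex coordinates `x₀ + i x₂`, `x₁ + i x₃`. -/
def rotJ (q : Fin 4 → ℝ) : Fin 4 → ℝ := ![-q 2, -q 3, q 0, q 1]

/-- The complexification of a symmetric matrix, applied to a vector. -/
def cmul (A : Matrix (Fin 4) (Fin 4) ℝ) (q : Fin 4 → ℝ) : Fin 4 → ℝ :=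
  ![(A 0 0 + A 2 2) * q 0 + (A 0 1 + A 2 3) * q 1 + (A 0 3 - A 2 1) * q 3,
    (A 0 1 + A 2 3) * q 0 + (A 1 1 + A 3 3) * q 1 - (A 0 3 - A 2 1) * q 2,
    (A 0 0 + A 2 2) * q 2 - (A 0 3 - A 2 1) * q 1 + (A 0 1 + A 2 3) * q 3,
    (A 0 3 - A 2 1) * q 0 + (A 0 1 + A 2 3) * q 2 + (A 1 1 + A 3 3) * q 3]

/-- The quadratic form of the complexification of `A`. -/
def cform (A : Matrix (Fin 4) (Fin 4) ℝ) (q : Fin 4 → ℝ) : ℝ := ∑ i, q i * cmul A q i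

/-- `q` spans the complex orthogonal complement of `p`, and `κ = |p|²`. -/
structure IsPerp (p q : Fin 4 → ℝ) (κ : ℝ) : Prop where
  eq₁ : p 1 ^ 2 + p 3 ^ 2 = κ * (q 0 ^ 2 + q 2 ^ 2)
  eq₂ : p 0 ^ 2 + p 2 ^ 2 = κ * (q 1 ^ 2 + q 3 ^ 2)
  eqr : p 0 * p 1 + p 2 * p 3 = -(κ * (q 0 * q 1 + q 2 * q 3))
  eqi : p 0 * p 3 - p 1 * p 2 = -(κ * (q 0 * q 3 - q 1 * q 2))
  unit : ∑ i, q i ^ 2 = 1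

/-- The adjugate of a rank-one Hermitian 2×2 matrix is again rank one. In complex notation, for `p ≠
0`, `q` is the normalised vector (conj P₂, -conj P₁); for `p = 0` any unit vector serves, since `κ =
0`. -/
theorem exists_isPerp (p : Fin 4 → ℝ) : ∃ q κ, IsPerp p q κ ∧ 0 ≤ κ ∧ κ = ∑ i, p i ^ 2 := by
  by_cases h : ∑ i, p i ^ 2 = 0
  · have hp : ∀ i, p i = 0 := by
      intro i
      have := (Finset.sum_eq_zero_iff_of_nonneg (fun i _ => sq_nonneg (p i))).1 h i
        (Finset.mem_univ i)
      exact pow_eq_zero_iff (two_ne_zero) |>.1 this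
    exact ⟨![1, 0, 0, 0], 0, by constructor <;> simp [hp, Fin.sum_univ_four], le_rfl, h.symm⟩
  · have hκ : 0 < ∑ i, p i ^ 2 :=
      lt_of_le_of_ne (Finset.sum_nonneg fun i _ => sq_nonneg _) (Ne.symm h)
    set κ := ∑ i, p i ^ 2 with hκd
    obtain ⟨s, hs⟩ : ∃ s : ℝ, κ * s ^ 2 = 1 :=
      ⟨(Real.sqrt κ)⁻¹, by rw [inv_pow, Real.sq_sqrt hκ.le, mul_inv_cancel₀ h]⟩
    refine ⟨![s * p 1, -(s * p 0), -(s * p 3), s * p 2], κ, ?_, hκ.le, rfl⟩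
    rw [Fin.sum_univ_four] at hκd
    constructor
    · simp; linear_combination -(p 1 ^ 2 + p 3 ^ 2) * hs
    · simp; linear_combination -(p 0 ^ 2 + p 2 ^ 2) * hs
    · simp; linear_combination -(p 0 * p 1 + p 2 * p 3) * hs
    · simp; linear_combination -(p 0 * p 3 - p 1 * p 2) * hs
    · simp [Fin.sum_univ_four]; linear_combination hs - s ^ 2 * hκd

/-- The linear map (as a matrix with rows `T_i`) that corrects the test direction. -/
def corr (a c : ℝ) (u q : Fin 4 → ℝ) : Matrix (Fin 4) (Fin 4) ℝ :=
  Matrix.of fun i k => a * (if i = k then 1 else 0) - c * (u i * q k + rotJ u i * rotJ q k)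

variable {A X : Matrix (Fin 4) (Fin 4) ℝ} {p q : Fin 4 → ℝ} {z z' a c κ : ℝ}

/-- The contraction of the coefficient matrix with a symmetric matrix. -/
def lin (A : Matrix (Fin 4) (Fin 4) ℝ) (p : Fin 4 → ℝ) (z : ℝ) (X : Matrix (Fin 4) (Fin 4) ℝ) : ℝ :=
  ∑ i, ∑ j, coefMat A p z i j * X i j

/-- `coefMat` commutes with `rotJ`, so the terms of `corr` containing `q` and `rotJ q` combine and
`X` enters only through its complexification. The same mechanism, together with the vanishing of the
coefficient form on `(u, rotJ u)`, gives `lin_corr_corr`. -/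
theorem lin_corr (hX : X.IsSymm) (u : Fin 4 → ℝ) :
    ∑ i, ∑ j, coefMat A p z i j * ∑ k, corr a c u q i k * X k j
      = a * lin A p z X - c * ∑ i, ∑ j, coefMat A p z i j * (u i * cmul X q j) := by
  have e : ∀ i j, X i j = X j i := fun i j => hX.apply j i
  simp only [lin, Fin.sum_univ_four, coefMat, corr, rotJ, cmul, Matrix.of_apply]
  simp [e 1 0, e 2 0, e 3 0, e 2 1, e 3 1, e 3 2]
  ring

theorem lin_corr_corr (hA : A.IsSymm) (u : Fin 4 → ℝ) :
    ∑ i, ∑ j, coefMat A p z i j * ∑ k, ∑ l, corr a c u q i k * A k l * corr a c u q j l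
      = a ^ 2 * lin A p z A - 2 * a * c * (∑ i, ∑ j, coefMat A p z i j * (u i * cmul A q j))
        + c ^ 2 * (∑ i, ∑ j, coefMat A p z i j * (u i * u j)) * cform A q := by
  have e : ∀ i j, A i j = A j i := fun i j => hA.apply j i
  simp only [lin, Fin.sum_univ_four, coefMat, corr, rotJ, cmul, cform, Matrix.of_apply]
  simp [e 1 0, e 2 0, e 3 0, e 2 1, e 3 1, e 3 2]
  ring

end ConstRank

namespace ConstRank

variable {A X : Matrix (Fin 4) (Fin 4) ℝ} {p q : Fin 4 → ℝ} {z z' a c κ : ℝ}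

theorem gradForm_self (h : IsPerp p q κ) : gradForm p p A = κ * cform A q := by
  simp only [gradForm, cform, cmul, Fin.sum_univ_four]
  simp
  linear_combination (A 0 0 + A 2 2) * h.eq₁ + (A 1 1 + A 3 3) * h.eq₂
    - 2 * (A 0 1 + A 2 3) * h.eqr - 2 * (A 0 3 - A 2 1) * h.eqi

/-- The second derivative of `F` at frozen gradient, in the direction `(X, z')`. -/
def frozenSnd (A : Matrix (Fin 4) (Fin 4) ℝ) (p : Fin 4 → ℝ) (z : ℝ)
    (X : Matrix (Fin 4) (Fin 4) ℝ) (z' : ℝ) : ℝ :=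
  2 * z' ^ 2 * cdet A + 4 * z * z' * cdetPolar A X + 2 * z ^ 2 * cdet X
    + 2 * z' * gradForm p p X

/-- The first derivative of `F` at frozen gradient, in the direction `(X, z')`. -/
def frozenFst (A : Matrix (Fin 4) (Fin 4) ℝ) (p : Fin 4 → ℝ) (z : ℝ)
    (X : Matrix (Fin 4) (Fin 4) ℝ) (z' : ℝ) : ℝ :=
  lin A p z X + z' * (2 * z * cdet A + gradForm p p A)

theorem lin_eq (h : IsPerp p q κ) (Y : Matrix (Fin 4) (Fin 4) ℝ) (hY : Y.IsSymm) :
    lin A p z Y = z ^ 2 * cdetPolar A Y + z * κ * cform Y q := by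
  have e : ∀ i j, Y i j = Y j i := fun i j => hY.apply j i
  simp only [lin, coefMat, h.eq₁, h.eq₂, h.eqr, h.eqi, cdetPolar, cform, cmul, Fin.sum_univ_four]
  simp [e 1 0, e 2 0, e 3 0, e 2 1, e 3 1, e 3 2]
  ring

-- The computation behind `frozen_identity`, in terms of Hermitian 2×2 matrices: h and k complexify
-- A and X, d = zk + z'h is the variation of zh, and u = dq. The engine is the polarised
-- Cayley-Hamilton relation d·adj(m)·d = tr(adj(m)d)·d - det(d)·m evaluated at q, where q*mq =
-- z·q*hq because q is orthogonal to the gradient (`hBu`). Normalising c·z·q*hq = 1 turns the det(d)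
-- term into exactly the frozen second-order contribution; tr(adj(m)d) is the frozen first
-- derivative (`hε`) and accounts for the remainder.
set_option linter.unusedVariables false in
theorem reduced_identity (h₁ h₂ hr hi k₁ k₂ kr ki q₀ q₁ q₂ q₃ z z' a c κ : ℝ)
    (hc : c * z * (h₁ * (q₀ ^ 2 + q₂ ^ 2) + h₂ * (q₁ ^ 2 + q₃ ^ 2) + 2 * hr * (q₀ * q₁ + q₂ * q₃)
      + 2 * hi * (q₀ * q₃ - q₁ * q₂)) = 1) (ha : z' = a * z) :
    let C : (ℝ × ℝ × ℝ × ℝ) → Fin 4 → ℝ := fun y =>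
      ![y.1 * q₀ + y.2.2.1 * q₁ + y.2.2.2 * q₃, y.2.2.1 * q₀ + y.2.1 * q₁ - y.2.2.2 * q₂,
        y.1 * q₂ - y.2.2.2 * q₁ + y.2.2.1 * q₃, y.2.2.2 * q₀ + y.2.2.1 * q₂ + y.2.1 * q₃]
    let d₁ := z * k₁ + z' * h₁
    let d₂ := z * k₂ + z' * h₂
    let dr := z * kr + z' * hr
    let di := z * ki + z' * hi
    let u := C (d₁, d₂, dr, di)
    let m₁ := z * h₁ + κ * (q₁ ^ 2 + q₃ ^ 2)
    let m₂ := z * h₂ + κ * (q₀ ^ 2 + q₂ ^ 2)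
    let mr := z * hr - κ * (q₀ * q₁ + q₂ * q₃)
    let mi := z * hi - κ * (q₀ * q₃ - q₁ * q₂)
    let B : (Fin 4 → ℝ) → (Fin 4 → ℝ) → ℝ := fun x y =>
      z * (m₂ * (x 0 * y 0 + x 2 * y 2) + m₁ * (x 1 * y 1 + x 3 * y 3)
        - mr * (x 0 * y 1 + x 1 * y 0 + x 2 * y 3 + x 3 * y 2)
        - mi * (x 0 * y 3 + x 3 * y 0 - x 1 * y 2 - x 2 * y 1))
    let L : ℝ → ℝ → ℝ → ℝ → ℝ := fun y₁ y₂ yr yi =>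
      z * (m₂ * y₁ + m₁ * y₂ - 2 * mr * yr - 2 * mi * yi)
    let Q : ℝ → ℝ → ℝ → ℝ → ℝ := fun y₁ y₂ yr yi =>
      y₁ * (q₀ ^ 2 + q₂ ^ 2) + y₂ * (q₁ ^ 2 + q₃ ^ 2) + 2 * yr * (q₀ * q₁ + q₂ * q₃)
        + 2 * yi * (q₀ * q₃ - q₁ * q₂)
    4 * (a * L k₁ k₂ kr ki - c * B u (C (k₁, k₂, kr, ki)))
      + 2 * (a ^ 2 * L h₁ h₂ hr hi - 2 * a * c * B u (C (h₁, h₂, hr, hi))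
        + c ^ 2 * B u u * Q h₁ h₂ hr hi)
      = 2 * z' ^ 2 * (h₁ * h₂ - hr ^ 2 - hi ^ 2)
        + 4 * z * z' * (h₁ * k₂ + h₂ * k₁ - 2 * hr * kr - 2 * hi * ki)
        + 2 * z ^ 2 * (k₁ * k₂ - kr ^ 2 - ki ^ 2) + 2 * z' * (κ * Q k₁ k₂ kr ki)
        + (L k₁ k₂ kr ki + z' * (2 * z * (h₁ * h₂ - hr ^ 2 - hi ^ 2) + κ * Q h₁ h₂ hr hi))
          * (2 * a - 2 * c * Q d₁ d₂ dr di) := by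
  intro C d₁ d₂ dr di u m₁ m₂ mr mi B L Q
  -- the adjugate form of `m` divided by `z`
  have hBu : B u u = z * ((m₂ * d₁ + m₁ * d₂ - 2 * mr * dr - 2 * mi * di) * Q d₁ d₂ dr di
      - (d₁ * d₂ - dr ^ 2 - di ^ 2) * (z * Q h₁ h₂ hr hi)) := by
    simp only [B, u, C, Q, m₁, m₂, mr, mi]
    simp [-mul_eq_mul_left_iff]
    ring
  have hBk : z * B u (C (k₁, k₂, kr, ki)) = B u u - z' * B u (C (h₁, h₂, hr, hi)) := by
    simp only [B, u, C, d₁, d₂, dr, di]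
    simp
    ring
  have hBk' : c * B u (C (k₁, k₂, kr, ki)) + a * c * B u (C (h₁, h₂, hr, hi))
      = c ^ 2 * Q h₁ h₂ hr hi * B u u := by
    have hc' : c * z * Q h₁ h₂ hr hi = 1 := hc
    have hz : z ≠ 0 := by rintro rfl; simp at hc
    apply mul_left_cancel₀ hz
    linear_combination c * hBk - c * B u (C (h₁, h₂, hr, hi)) * ha - c * B u u * hc'
  have hc' : c * z * Q h₁ h₂ hr hi = 1 := hc
  have hq : 2 * c ^ 2 * Q h₁ h₂ hr hi * B u u
      = 2 * c * (m₂ * d₁ + m₁ * d₂ - 2 * mr * dr - 2 * mi * di) * Q d₁ d₂ dr di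
        - 2 * (d₁ * d₂ - dr ^ 2 - di ^ 2) := by
    rw [hBu]
    linear_combination (2 * c * (m₂ * d₁ + m₁ * d₂ - 2 * mr * dr - 2 * mi * di) * Q d₁ d₂ dr di
      - 2 * (d₁ * d₂ - dr ^ 2 - di ^ 2) * (c * z * Q h₁ h₂ hr hi + 1)) * hc'
  have hε : L k₁ k₂ kr ki + z' * (2 * z * (h₁ * h₂ - hr ^ 2 - hi ^ 2) + κ * Q h₁ h₂ hr hi)
      = m₂ * d₁ + m₁ * d₂ - 2 * mr * dr - 2 * mi * di := by
    simp only [L, Q, m₁, m₂, mr, mi, d₁, d₂, dr, di]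
    ring
  have hrest : 4 * a * L k₁ k₂ kr ki + 2 * a ^ 2 * L h₁ h₂ hr hi
      + 2 * (d₁ * d₂ - dr ^ 2 - di ^ 2)
      = 2 * z' ^ 2 * (h₁ * h₂ - hr ^ 2 - hi ^ 2)
        + 4 * z * z' * (h₁ * k₂ + h₂ * k₁ - 2 * hr * kr - 2 * hi * ki)
        + 2 * z ^ 2 * (k₁ * k₂ - kr ^ 2 - ki ^ 2) + 2 * z' * (κ * Q k₁ k₂ kr ki)
        + 2 * a * (m₂ * d₁ + m₁ * d₂ - 2 * mr * dr - 2 * mi * di) := by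
    simp only [L, Q, m₁, m₂, mr, mi, d₁, d₂, dr, di, ha]
    ring
  rw [hε]
  linear_combination hrest - 4 * hBk' - hq

set_option linter.unusedVariables false in
/-- The structural identity: with the corrected test direction, the second order terms of the
differentiated equation cancel up to a multiple of its first derivative. -/
theorem frozen_identity (hA : A.IsSymm) (hX : X.IsSymm) (h : IsPerp p q κ)
    (hc : c * z * cform A q = 1) (ha : z' = a * z) :
    let u := cmul (z • X + z' • A) q
    ∑ i, ∑ j, coefMat A p z i j * (4 * ∑ k, corr a c u q i k * X k j
        + 2 * ∑ k, ∑ l, corr a c u q i k * A k l * corr a c u q j l)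
      = frozenSnd A p z X z' + frozenFst A p z X z' * (2 * a - 2 * c * cform (z • X + z' • A) q) := by
  intro u
  have hsplit : ∑ i, ∑ j, coefMat A p z i j * (4 * ∑ k, corr a c u q i k * X k j
        + 2 * ∑ k, ∑ l, corr a c u q i k * A k l * corr a c u q j l)
      = 4 * (∑ i, ∑ j, coefMat A p z i j * ∑ k, corr a c u q i k * X k j)
        + 2 * ∑ i, ∑ j, coefMat A p z i j
          * ∑ k, ∑ l, corr a c u q i k * A k l * corr a c u q j l := by
    have gen : ∀ x y : Fin 4 → Fin 4 → ℝ, ∑ i, ∑ j, coefMat A p z i j * (4 * x i j + 2 * y i j)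
        = 4 * (∑ i, ∑ j, coefMat A p z i j * x i j)
          + 2 * ∑ i, ∑ j, coefMat A p z i j * y i j := by
      intro x y
      simp only [Fin.sum_univ_four]
      ring
    exact gen _ _
  have hcf : ∀ Y : Matrix (Fin 4) (Fin 4) ℝ, cform Y q = (Y 0 0 + Y 2 2) * (q 0 ^ 2 + q 2 ^ 2)
      + (Y 1 1 + Y 3 3) * (q 1 ^ 2 + q 3 ^ 2) + 2 * (Y 0 1 + Y 2 3) * (q 0 * q 1 + q 2 * q 3)
      + 2 * (Y 0 3 - Y 2 1) * (q 0 * q 3 - q 1 * q 2) := by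
    intro Y
    simp only [cform, cmul, Fin.sum_univ_four]
    simp
    ring
  rw [hcf] at hc
  have key := reduced_identity (A 0 0 + A 2 2) (A 1 1 + A 3 3) (A 0 1 + A 2 3) (A 0 3 - A 2 1)
    (X 0 0 + X 2 2) (X 1 1 + X 3 3) (X 0 1 + X 2 3) (X 0 3 - X 2 1) (q 0) (q 1) (q 2) (q 3)
    z z' a c κ hc ha
  have hB : ∀ x y : Fin 4 → ℝ, ∑ i, ∑ j, coefMat A p z i j * (x i * y j)
      = z * ((z * (A 1 1 + A 3 3) + κ * (q 0 ^ 2 + q 2 ^ 2)) * (x 0 * y 0 + x 2 * y 2)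
        + (z * (A 0 0 + A 2 2) + κ * (q 1 ^ 2 + q 3 ^ 2)) * (x 1 * y 1 + x 3 * y 3)
        - (z * (A 0 1 + A 2 3) - κ * (q 0 * q 1 + q 2 * q 3))
          * (x 0 * y 1 + x 1 * y 0 + x 2 * y 3 + x 3 * y 2)
        - (z * (A 0 3 - A 2 1) - κ * (q 0 * q 3 - q 1 * q 2))
          * (x 0 * y 3 + x 3 * y 0 - x 1 * y 2 - x 2 * y 1)) := by
    intro x y
    simp only [coefMat, h.eq₁, h.eq₂, h.eqr, h.eqi, Fin.sum_univ_four]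
    simp
    ring
  have hu : u = ![(z * (X 0 0 + X 2 2) + z' * (A 0 0 + A 2 2)) * q 0
        + (z * (X 0 1 + X 2 3) + z' * (A 0 1 + A 2 3)) * q 1
        + (z * (X 0 3 - X 2 1) + z' * (A 0 3 - A 2 1)) * q 3,
      (z * (X 0 1 + X 2 3) + z' * (A 0 1 + A 2 3)) * q 0
        + (z * (X 1 1 + X 3 3) + z' * (A 1 1 + A 3 3)) * q 1
        - (z * (X 0 3 - X 2 1) + z' * (A 0 3 - A 2 1)) * q 2,
      (z * (X 0 0 + X 2 2) + z' * (A 0 0 + A 2 2)) * q 2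
        - (z * (X 0 3 - X 2 1) + z' * (A 0 3 - A 2 1)) * q 1
        + (z * (X 0 1 + X 2 3) + z' * (A 0 1 + A 2 3)) * q 3,
      (z * (X 0 3 - X 2 1) + z' * (A 0 3 - A 2 1)) * q 0
        + (z * (X 0 1 + X 2 3) + z' * (A 0 1 + A 2 3)) * q 2
        + (z * (X 1 1 + X 3 3) + z' * (A 1 1 + A 3 3)) * q 3] := by
    funext i
    fin_cases i <;> simp [u, cmul] <;> ring
  rw [hsplit, lin_corr hX, lin_corr_corr hA, frozenFst, frozenSnd, gradForm_self h,
    gradForm_self h, lin_eq h A hA, lin_eq h X hX, hB, hB, hB, hu]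
  simp only [cmul, hcf, cdet, cdetPolar, Matrix.add_apply, Matrix.smul_apply, smul_eq_mul]
  simp only [] at key
  linear_combination key

end ConstRank

/-! ### Pointwise ellipticity -/

namespace ConstRank

section Pointwise

variable {A : Matrix (Fin 4) (Fin 4) ℝ} {p q : Fin 4 → ℝ} {z κ : ℝ}

theorem opF_eq (hA : A.IsSymm) : opF A p z = z ^ 2 * cdet A + z * gradForm p p A - 1 := by
  have e : ∀ i j, A i j = A j i := fun i j => hA.apply j i
  simp only [opF, cdet, gradForm, e 1 0, e 3 0, e 2 1, e 3 2]
  ring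

theorem lin_eq_gradForm {Y : Matrix (Fin 4) (Fin 4) ℝ} (hY : Y.IsSymm) :
    lin A p z Y = z ^ 2 * cdetPolar A Y + z * gradForm p p Y := by
  have e : ∀ i j, Y i j = Y j i := fun i j => hY.apply j i
  simp only [lin, coefMat, cdetPolar, gradForm, Fin.sum_univ_four]
  simp [e 1 0, e 2 0, e 3 0, e 2 1, e 3 1, e 3 2]
  ring

/-- Half of the trace of the coefficient matrix. -/
def halfTrace (A : Matrix (Fin 4) (Fin 4) ℝ) (p : Fin 4 → ℝ) (z : ℝ) : ℝ :=
  z ^ 2 * (A 0 0 + A 2 2 + (A 1 1 + A 3 3)) + z * ∑ i, p i ^ 2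

theorem trace_coefMat : ∑ i, coefMat A p z i i = 2 * halfTrace A p z := by
  simp [coefMat, halfTrace, Fin.sum_univ_four]
  ring

/-- The bilinear form of a matrix. -/
def form (A : Matrix (Fin 4) (Fin 4) ℝ) (a b : Fin 4 → ℝ) : ℝ := ∑ i, ∑ j, A i j * (a i * b j)

theorem form_nonneg (hA : A.PosSemidef) (x : Fin 4 → ℝ) : 0 ≤ form A x x := by
  have := hA.dotProduct_mulVec_nonneg x
  simp only [dotProduct, Matrix.mulVec, Pi.star_apply, star_trivial, Finset.mul_sum] at this
  simpa only [form, mul_left_comm] using this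

/-- The correction divides by `cform A q`, so it needs a lower bound. Cauchy-Schwarz and
Cayley-Hamilton give (q*Hq)² ≤ |Hq|² = tr H · q*Hq - det H; multiplying by z² and eliminating det H
with the equation yields `1 + z² cform² ≤ cform * halfTrace`. -/
theorem cform_bounds (hA : A.PosSemidef) (h0 : opF A p z = 0) (h : IsPerp p q κ)
    (hκ : κ = ∑ i, p i ^ 2) :
    0 < cform A q ∧ 0 < halfTrace A p z ∧ (cform A q)⁻¹ ≤ halfTrace A p z := by
  have hs : A.IsSymm := by simpa [Matrix.IsHermitian, Matrix.IsSymm] using hA.1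
  have e : ∀ i j, A i j = A j i := fun i j => hs.apply j i
  have hg : 0 ≤ cform A q := by
    have h1 := form_nonneg hA q
    have h2 := form_nonneg hA (rotJ q)
    have : cform A q = form A q q + form A (rotJ q) (rotJ q) := by
      simp only [form, cform, cmul, rotJ, Fin.sum_univ_four]
      simp [e 1 0, e 2 0, e 3 0, e 2 1, e 3 1, e 3 2]
      ring
    linarith
  rw [opF_eq hs, gradForm_self h] at h0
  have hunit := h.unit
  have hsq : ∑ i, cmul A q i ^ 2
      = (A 0 0 + A 2 2 + (A 1 1 + A 3 3)) * cform A q - cdet A * ∑ i, q i ^ 2 := by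
    simp only [cform, cmul, cdet, Fin.sum_univ_four]
    simp
    ring
  have hcs : cform A q ^ 2 ≤ (∑ i, q i ^ 2) * ∑ i, cmul A q i ^ 2 :=
    Finset.sum_mul_sq_le_sq_mul_sq _ _ _
  rw [hsq, hunit, one_mul, mul_one] at hcs
  have hz : 0 ≤ z ^ 2 := sq_nonneg z
  have key : 1 + z ^ 2 * cform A q ^ 2 ≤ cform A q * halfTrace A p z := by
    rw [halfTrace, ← hκ]
    nlinarith [mul_le_mul_of_nonneg_left hcs hz]
  have hprod : 1 ≤ cform A q * halfTrace A p z := by nlinarith [sq_nonneg (z * cform A q)]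
  have hgpos : 0 < cform A q := by
    refine lt_of_le_of_ne hg fun h => ?_
    rw [← h] at hprod
    linarith
  refine ⟨hgpos, ?_, ?_⟩
  · by_contra! hneg
    nlinarith
  · rw [inv_le_iff_one_le_mul₀ hgpos, mul_comm]
    exact hprod

/-- Cayley-Hamilton for the complex 2×2 matrix a = z·adj(m): its trace is `halfTrace` and its
determinant is z²·det m = z² by the equation, so `halfTrace` times the form of a equals |aξ|² +
z²|ξ|². -/
theorem coefMat_elliptic (hs : A.IsSymm) (h0 : opF A p z = 0) (ξ : Fin 4 → ℝ) :
    z ^ 2 * ∑ i, ξ i ^ 2 ≤ halfTrace A p z * ∑ i, ∑ j, coefMat A p z i j * (ξ i * ξ j) := by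
  rw [opF_eq hs] at h0
  have : halfTrace A p z * ∑ i, ∑ j, coefMat A p z i j * (ξ i * ξ j)
      = ∑ i, (∑ j, coefMat A p z i j * ξ j) ^ 2
        + z ^ 2 * (z ^ 2 * cdet A + z * gradForm p p A) * ∑ i, ξ i ^ 2 := by
    simp only [coefMat, halfTrace, cdet, gradForm, Fin.sum_univ_four]
    simp
    ring
  rw [this, show z ^ 2 * cdet A + z * gradForm p p A = 1 by linarith, mul_one]
  have : 0 ≤ ∑ i, (∑ j, coefMat A p z i j * ξ j) ^ 2 := Finset.sum_nonneg fun i _ => sq_nonneg _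
  linarith

end Pointwise

/-! ### Differentiating the equation along an eigendirection -/

section Jets

variable {A : ℝ → Matrix (Fin 4) (Fin 4) ℝ} {A₀ X Y : Matrix (Fin 4) (Fin 4) ℝ}
  {p : ℝ → Fin 4 → ℝ} {p₀ p₁ p₂ : Fin 4 → ℝ}

theorem hasJet_cdet (hA : ∀ i j, HasJet (fun t => A t i j) (A₀ i j) (X i j) (Y i j)) :
    HasJet (fun t => cdet (A t)) (cdet A₀) (cdetPolar A₀ X) (cdetPolar A₀ Y + 2 * cdet X) := by
  have h1 := (hA 0 0).add (hA 2 2)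
  have h2 := (hA 1 1).add (hA 3 3)
  have hr := (hA 0 1).add (hA 2 3)
  have hi := (hA 0 3).sub (hA 2 1)
  refine (((h1.mul h2).sub (hr.mul hr)).sub (hi.mul hi)).congr_fun (.of_forall fun t => ?_)
    |>.congr ?_ ?_ ?_
  all_goals simp only [cdet, cdetPolar]; ring

theorem hasJet_gradForm (hA : ∀ i j, HasJet (fun t => A t i j) (A₀ i j) (X i j) (Y i j))
    (hp : ∀ i, HasJet (fun t => p t i) (p₀ i) (p₁ i) (p₂ i)) :
    HasJet (fun t => gradForm (p t) (p t) (A t)) (gradForm p₀ p₀ A₀)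
      (2 * gradForm p₀ p₁ A₀ + gradForm p₀ p₀ X)
      (2 * gradForm p₀ p₂ A₀ + 2 * gradForm p₁ p₁ A₀ + 4 * gradForm p₀ p₁ X
        + gradForm p₀ p₀ Y) := by
  have h1 := (hA 0 0).add (hA 2 2)
  have h2 := (hA 1 1).add (hA 3 3)
  have hr := (hA 0 1).add (hA 2 3)
  have hi := (hA 0 3).sub (hA 2 1)
  have b1 := ((hp 1).mul (hp 1)).add ((hp 3).mul (hp 3))
  have b2 := ((hp 0).mul (hp 0)).add ((hp 2).mul (hp 2))
  have br := (((hp 0).mul (hp 1)).add ((hp 2).mul (hp 3))).const_mul 2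
  have bi := (((hp 0).mul (hp 3)).sub ((hp 1).mul (hp 2))).const_mul 2
  refine ((((b1.mul h1).add (b2.mul h2)).sub (br.mul hr)).sub (bi.mul hi)).congr_fun
    (.of_forall fun t => ?_) |>.congr ?_ ?_ ?_
  all_goals simp only [gradForm]; ring

end Jets

/-- Third derivatives. -/
noncomputable def D3 (v : E4 → ℝ) (x : E4) (i j k : Fin 4) : ℝ := pd k (pd j (pd i v)) x

/-- Fourth derivatives. -/
noncomputable def D4 (v : E4 → ℝ) (x : E4) (i j k l : Fin 4) : ℝ := pd l (pd k (pd j (pd i v))) x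

/-- The derivative of the Hessian in direction `f`. -/
noncomputable def hess₁ (v : E4 → ℝ) (x : E4) (f : Fin 4 → ℝ) : Matrix (Fin 4) (Fin 4) ℝ :=
  Matrix.of fun i j => ∑ k, f k * D3 v x i j k

/-- The second derivative of the Hessian in direction `f`. -/
noncomputable def hess₂ (v : E4 → ℝ) (x : E4) (f : Fin 4 → ℝ) : Matrix (Fin 4) (Fin 4) ℝ :=
  Matrix.of fun i j => ∑ k, ∑ l, f k * f l * D4 v x i j k l

/-- The derivative of the quadratic form `f ↦ ∇²v(f, f)`. -/
noncomputable def grad₃ (v : E4 → ℝ) (x : E4) (f : Fin 4 → ℝ) (i : Fin 4) : ℝ :=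
  ∑ k, ∑ l, f k * f l * D3 v x i k l

/-- The coefficient matrix of the linearised operator at `x`. -/
noncomputable def coefAt (v : E4 → ℝ) (x : E4) : Matrix (Fin 4) (Fin 4) ℝ :=
  coefMat (hess v x) (fun k => pd k v x) (v x)

section Solution

variable {Ω : Set E4} {v : E4 → ℝ} {x : E4}

theorem contDiffOn_hess (hΩ : IsOpen Ω) (hv : ContDiffOn ℝ 4 v Ω) (i j : Fin 4) :
    ContDiffOn ℝ 2 (fun y => hess v y i j) Ω :=
  contDiffOn_pd (n := 3) (m := 2) hΩ (contDiffOn_pd (n := 4) (m := 3) hΩ hv le_rfl i) le_rfl j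

theorem D3_comm₁ (hΩ : IsOpen Ω) (hv : ContDiffOn ℝ 4 v Ω) (hx : x ∈ Ω) (i j k : Fin 4) :
    D3 v x i j k = D3 v x j i k :=
  pd_congr hΩ hx (fun _ hy => pd_comm hΩ (hv.of_le (by norm_num)) hy j i) k

theorem D3_comm₂ (hΩ : IsOpen Ω) (hv : ContDiffOn ℝ 4 v Ω) (hx : x ∈ Ω) (i j k : Fin 4) :
    D3 v x i j k = D3 v x i k j :=
  pd_comm hΩ ((contDiffOn_pd (n := 4) (m := 3) hΩ hv le_rfl i).of_le (by norm_num)) hx k j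

theorem D4_comm (hΩ : IsOpen Ω) (hv : ContDiffOn ℝ 4 v Ω) (hx : x ∈ Ω) (i j k l : Fin 4) :
    D4 v x i j k l = D4 v x k l i j := by
  have e1 : D4 v x i j k l = D4 v x i k j l :=
    pd_congr hΩ hx (fun _ hy => D3_comm₂ hΩ hv hy i j k) l
  have e2 : D4 v x i k j l = D4 v x k i j l :=
    pd_congr hΩ hx (fun _ hy => D3_comm₁ hΩ hv hy i k j) l
  have e3 : D4 v x k i j l = D4 v x k i l j :=
    pd_comm hΩ (contDiffOn_hess hΩ hv k i) hx l j
  have e4 : D4 v x k i l j = D4 v x k l i j :=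
    pd_congr hΩ hx (fun _ hy => D3_comm₂ hΩ hv hy k i l) j
  rw [e1, e2, e3, e4]

theorem hasJet_hess (hΩ : IsOpen Ω) (hv : ContDiffOn ℝ 4 v Ω) (hx : x ∈ Ω) (f : Fin 4 → ℝ)
    (i j : Fin 4) :
    HasJet (fun t => hess v (x + t • vec f) i j) (hess v x i j) (hess₁ v x f i j)
      (hess₂ v x f i j) :=
  hasJet_line hΩ (contDiffOn_hess hΩ hv i j) hx f

theorem isSymm_hess (hpsd : ∀ y ∈ Ω, (hess v y).PosSemidef) (hx : x ∈ Ω) : (hess v x).IsSymm := by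
  simpa [Matrix.IsHermitian, Matrix.IsSymm] using (hpsd x hx).1

theorem isSymm_hess₁ (hΩ : IsOpen Ω) (hv : ContDiffOn ℝ 4 v Ω) (hx : x ∈ Ω) (f : Fin 4 → ℝ) :
    (hess₁ v x f).IsSymm := by
  ext i j
  simp [hess₁, D3_comm₁ hΩ hv hx i j]

theorem isSymm_hess₂ (hΩ : IsOpen Ω) (hv : ContDiffOn ℝ 4 v Ω) (hx : x ∈ Ω) (f : Fin 4 → ℝ) :
    (hess₂ v x f).IsSymm := by
  ext i j
  have : ∀ k l, D4 v x j i k l = D4 v x i j k l := by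
    intro k l
    rw [D4_comm hΩ hv hx, D4_comm hΩ hv hx i j]
    exact pd_comm hΩ (contDiffOn_hess hΩ hv k l) hx i j
  simp [hess₂, this]

variable {f : Fin 4 → ℝ} {lam : ℝ}

/-- The equation, differentiated once and twice along an eigendirection of the Hessian. -/
theorem differentiated_equation (hΩ : IsOpen Ω) (hv : ContDiffOn ℝ 4 v Ω)
    (hpsd : ∀ y ∈ Ω, (hess v y).PosSemidef) (heq : ∀ y ∈ Ω, opFAt v y = 0) (hx : x ∈ Ω)
    (hunit : ∑ i, f i ^ 2 = 1) (hf : ∀ i, ∑ j, hess v x i j * f j = lam * f i) :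
    let A := hess v x
    let X := hess₁ v x f
    let p := fun k => pd k v x
    let z' := ∑ k, f k * pd k v x
    frozenFst A p (v x) X z' = -(2 * v x * lam * gradForm p f A) ∧
    lin A p (v x) (hess₂ v x f) + frozenSnd A p (v x) X z'
      = -(lam * (2 * v x * cdet A + gradForm p p A)
        + v x * (2 * gradForm p (grad₃ v x f) A + 2 * lam ^ 2 * gradForm f f A
          + 4 * lam * gradForm p f X) + 4 * z' * lam * gradForm p f A) := by
  intro A X p z'
  have jA := hasJet_hess hΩ hv hx f
  -- Here the eigenvector hypothesis enters: to first order the gradient changes only by `lam * f`,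
  -- which puts the factor `lam` on every term with a first variation of the gradient.
  have jp : ∀ i, HasJet (fun t => pd i v (x + t • vec f)) (p i) (lam * f i) (grad₃ v x f i) := by
    intro i
    refine (hasJet_line hΩ ((contDiffOn_pd (n := 4) (m := 3) hΩ hv le_rfl i).of_le
      (by norm_num)) hx f).congr rfl ?_ rfl
    rw [← hf i]
    exact Finset.sum_congr rfl fun j _ => mul_comm _ _
  have jz : HasJet (fun t => v (x + t • vec f)) (v x) z' lam := by
    refine (hasJet_line hΩ (hv.of_le (by norm_num)) hx f).congr rfl rfl ?_
    calc ∑ k, ∑ l, f k * f l * pd l (pd k v) x = ∑ k, f k * ∑ l, hess v x k l * f l := by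
          refine Finset.sum_congr rfl fun k _ => ?_
          rw [Finset.mul_sum]
          refine Finset.sum_congr rfl fun l _ => ?_
          simp only [hess, Matrix.of_apply]
          ring
      _ = lam * ∑ k, f k ^ 2 := by
          rw [Finset.mul_sum]
          refine Finset.sum_congr rfl fun k _ => ?_
          rw [hf k]
          ring
      _ = lam := by rw [hunit, mul_one]
  have jF := ((((jz.mul jz).mul (hasJet_cdet jA)).add (jz.mul (hasJet_gradForm jA jp))).sub
    (HasJet.const 1)).eq_zero (by
      filter_upwards [eventually_line hΩ hx f] with t ht
      have h0 := heq _ ht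
      rw [opFAt, opF_eq (isSymm_hess hpsd ht)] at h0
      linarith)
  have hlX : lin A p (v x) X = _ := lin_eq_gradForm (isSymm_hess₁ hΩ hv hx f)
  have hlY : lin A p (v x) (hess₂ v x f) = _ := lin_eq_gradForm (isSymm_hess₂ hΩ hv hx f)
  have g1 : gradForm p (fun i => lam * f i) A = lam * gradForm p f A := by
    simp only [gradForm]; ring
  have g2 : gradForm (fun i => lam * f i) (fun i => lam * f i) A = lam ^ 2 * gradForm f f A := by
    simp only [gradForm]; ring
  have g3 : gradForm p (fun i => lam * f i) X = lam * gradForm p f X := by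
    simp only [gradForm]; ring
  obtain ⟨j1, j2⟩ := jF
  simp only [show hess v x = A from rfl, show hess₁ v x f = X from rfl, g1, g2, g3] at j1 j2
  rw [frozenFst, frozenSnd, hlX, hlY]
  constructor
  · linear_combination j1
  · linear_combination j2

end Solution

end ConstRank

/-! ### Locally uniform bounds for the correction -/

namespace ConstRank

section Continuity

variable {E : Type*} [TopologicalSpace E] {M N : E → Matrix (Fin 4) (Fin 4) ℝ}
  {p r : E → Fin 4 → ℝ} {a c : E → ℝ}

theorem continuous_cmul (hM : ∀ i j, Continuous fun P => M P i j)
    (hp : ∀ i, Continuous fun P => p P i) (i : Fin 4) : Continuous fun P => cmul (M P) (p P) i := by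
  fin_cases i <;> simp [cmul] <;> fun_prop

theorem continuous_rotJ (hp : ∀ i, Continuous fun P => p P i) (i : Fin 4) :
    Continuous fun P => rotJ (p P) i := by
  fin_cases i <;> simp [rotJ] <;> fun_prop

theorem continuous_cform (hM : ∀ i j, Continuous fun P => M P i j)
    (hp : ∀ i, Continuous fun P => p P i) : Continuous fun P => cform (M P) (p P) :=
  continuous_finsetSum _ fun i _ => (hp i).mul (continuous_cmul hM hp i)

theorem continuous_cdet (hM : ∀ i j, Continuous fun P => M P i j) :
    Continuous fun P => cdet (M P) := by
  unfold cdet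
  fun_prop

theorem continuous_gradForm (hM : ∀ i j, Continuous fun P => M P i j)
    (hp : ∀ i, Continuous fun P => p P i) (hr : ∀ i, Continuous fun P => r P i) :
    Continuous fun P => gradForm (p P) (r P) (M P) := by
  unfold gradForm
  fun_prop

theorem continuous_corr (ha : Continuous a) (hc : Continuous c)
    (hp : ∀ i, Continuous fun P => p P i) (hr : ∀ i, Continuous fun P => r P i) (i j : Fin 4) :
    Continuous fun P => corr (a P) (c P) (p P) (r P) i j := by
  have h1 := continuous_rotJ hp i
  have h2 := continuous_rotJ hr j
  simp only [corr, Matrix.of_apply]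
  fun_prop

end Continuity

/-- The symmetric-looking expression `∂²(∇²v)(f, f) + 4 ∇³v(T, f) + 2 ∇²v(T, T)`, as a matrix. -/
noncomputable def secVar (v : E4 → ℝ) (x : E4) (f : Fin 4 → ℝ) (T : Matrix (Fin 4) (Fin 4) ℝ) :
    Matrix (Fin 4) (Fin 4) ℝ :=
  Matrix.of fun i j => hess₂ v x f i j + (4 * ∑ k, T i k * hess₁ v x f k j
    + 2 * ∑ k, ∑ l, T i k * hess v x k l * T j l)

/-- The values on which the estimates depend: `v`, `v⁻¹`, `∇v`, `∇²v`, `∇³v`, the half trace of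
the coefficients, a direction, a vector complex orthogonal to `∇v`, and a reciprocal. -/
abbrev Data : Type :=
  (ℝ × ℝ × (Fin 4 → ℝ) × (Fin 4 → Fin 4 → ℝ) × (Fin 4 → Fin 4 → Fin 4 → ℝ) × ℝ) ×
    (Fin 4 → ℝ) × (Fin 4 → ℝ) × ℝ

namespace Data

variable (P : Data)

def z : ℝ := P.1.1
def zinv : ℝ := P.1.2.1
def p : Fin 4 → ℝ := P.1.2.2.1
def A : Matrix (Fin 4) (Fin 4) ℝ := P.1.2.2.2.1
def D : Fin 4 → Fin 4 → Fin 4 → ℝ := P.1.2.2.2.2.1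
def f : Fin 4 → ℝ := P.2.1
def q : Fin 4 → ℝ := P.2.2.1
def ginv : ℝ := P.2.2.2
def X : Matrix (Fin 4) (Fin 4) ℝ := Matrix.of fun i j => ∑ k, P.f k * P.D i j k
def z' : ℝ := ∑ k, P.f k * P.p k
-- `a` and `c` are the two normalisations required by `frozen_identity`. Stored reciprocals keep
-- every derived quantity polynomial in the data, hence continuous without any nonvanishing
-- condition.
def a : ℝ := P.z' * P.zinv
def c : ℝ := P.zinv * P.ginv
def Y : Matrix (Fin 4) (Fin 4) ℝ := P.z • P.X + P.z' • P.A
def T : Matrix (Fin 4) (Fin 4) ℝ := corr P.a P.c (cmul P.Y P.q) P.q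
def lam : ℝ := ∑ i, ∑ j, P.A i j * (P.f i * P.f j)
/-- The coefficient of the eigenvalue in the error term. -/
def U : ℝ :=
  -(2 * P.z * gradForm P.p P.f P.A) * (2 * P.a - 2 * P.c * cform P.Y P.q)
    - (2 * P.z * cdet P.A + gradForm P.p P.p P.A)
    - P.z * (2 * P.lam * gradForm P.f P.f P.A + 4 * gradForm P.p P.f P.X)
    - 4 * P.z' * gradForm P.p P.f P.A
/-- The coefficient of the gradient of the eigenvalue in the error term. -/
def V (k : Fin 4) : ℝ := -(2 * P.z * gradForm P.p (fun i => if i = k then 1 else 0) P.A)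

/-- Supplies bounds by compactness. The vector `q` is not chosen continuously in the base point, but
it is a unit vector, so boundedness of the data suffices. -/
theorem continuous_bound :
    Continuous fun P : Data => ∑ i, ∑ j, |P.T i j| + (|P.U| + ∑ k, |P.V k|) := by
  have hz : Continuous z := by unfold z; fun_prop
  have hzi : Continuous zinv := by unfold zinv; fun_prop
  have hg : Continuous ginv := by unfold ginv; fun_prop
  have hp : ∀ i, Continuous fun P : Data => P.p i := by intro i; unfold p; fun_prop
  have hf : ∀ i, Continuous fun P : Data => P.f i := by intro i; unfold f; fun_prop
  have hq : ∀ i, Continuous fun P : Data => P.q i := by intro i; unfold q; fun_prop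
  have hA : ∀ i j, Continuous fun P : Data => P.A i j := by intro i j; unfold A; fun_prop
  have hD : ∀ i j k, Continuous fun P : Data => P.D i j k := by intro i j k; unfold D; fun_prop
  have hX : ∀ i j, Continuous fun P : Data => P.X i j := by
    intro i j
    simp only [X, Matrix.of_apply]
    exact continuous_finsetSum _ fun k _ => (hf k).mul (hD i j k)
  have hz' : Continuous z' := continuous_finsetSum _ fun k _ => (hf k).mul (hp k)
  have ha : Continuous a := hz'.mul hzi
  have hc : Continuous c := hzi.mul hg
  have hY : ∀ i j, Continuous fun P : Data => P.Y i j := by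
    intro i j
    simp only [Y, Matrix.add_apply, Matrix.smul_apply, smul_eq_mul]
    exact (hz.mul (hX i j)).add (hz'.mul (hA i j))
  have hT : ∀ i j, Continuous fun P : Data => P.T i j :=
    continuous_corr ha hc (continuous_cmul hY hq) hq
  have hlam : Continuous lam := continuous_finsetSum _ fun i _ => continuous_finsetSum _ fun j _ =>
    (hA i j).mul ((hf i).mul (hf j))
  have hU : Continuous U := by
    have h1 := continuous_gradForm hA hp hf
    have h2 := continuous_cform hY hq
    have h3 := continuous_cdet hA
    have h4 := continuous_gradForm hA hp hp
    have h5 := continuous_gradForm hA hf hf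
    have h6 := continuous_gradForm hX hp hf
    unfold U
    fun_prop
  have hV : ∀ k, Continuous fun P : Data => P.V k := by
    intro k
    have := continuous_gradForm (r := fun _ : Data => fun i => if i = k then (1 : ℝ) else 0) hA hp
      (fun i => continuous_const)
    unfold V
    fun_prop
  refine .add (continuous_finsetSum _ fun i _ => continuous_finsetSum _ fun j _ => (hT i j).abs)
    (hU.abs.add (continuous_finsetSum _ fun k _ => (hV k).abs))

end Data

section Solution

variable {Ω : Set E4} {v : E4 → ℝ} {x : E4} {f : Fin 4 → ℝ} {lam : ℝ}

/-- The values of the derivatives of `v` at a point. -/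
noncomputable def jetAt (v : E4 → ℝ) (x : E4) :
    ℝ × ℝ × (Fin 4 → ℝ) × (Fin 4 → Fin 4 → ℝ) × (Fin 4 → Fin 4 → Fin 4 → ℝ) × ℝ :=
  (v x, (v x)⁻¹, fun k => pd k v x, hess v x, D3 v x, halfTrace (hess v x) (fun k => pd k v x) (v x))

theorem ne_zero_of_eq {A : Matrix (Fin 4) (Fin 4) ℝ} {p : Fin 4 → ℝ} {z : ℝ} (h : opF A p z = 0) :
    z ≠ 0 := by
  rintro rfl
  simp [opF] at h

/-- The contraction of the coefficients with the second variation, for a suitable correction. -/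
theorem contraction_eq (hΩ : IsOpen Ω) (hv : ContDiffOn ℝ 4 v Ω)
    (hpsd : ∀ y ∈ Ω, (hess v y).PosSemidef) (heq : ∀ y ∈ Ω, opFAt v y = 0) (hx : x ∈ Ω)
    (hunit : ∑ i, f i ^ 2 = 1) (hf : ∀ i, ∑ j, hess v x i j * f j = lam * f i)
    {q : Fin 4 → ℝ} {κ : ℝ} (hq : IsPerp (fun k => pd k v x) q κ) (hg : cform (hess v x) q ≠ 0) :
    let P : Data := (jetAt v x, f, q, (cform (hess v x) q)⁻¹)
    ∑ i, ∑ j, coefAt v x i j * secVar v x f P.T i j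
      = lam * P.U + ∑ k, grad₃ v x f k * P.V k := by
  intro P
  have hz : v x ≠ 0 := ne_zero_of_eq (heq x hx)
  obtain ⟨e1, e2⟩ := differentiated_equation hΩ hv hpsd heq hx hunit hf
  have hid := frozen_identity (A := hess v x) (X := hess₁ v x f) (p := fun k => pd k v x) (q := q)
    (z := v x) (z' := ∑ k, f k * pd k v x) (a := P.a) (c := P.c) (isSymm_hess hpsd hx)
    (isSymm_hess₁ hΩ hv hx f) hq
    (by change (v x)⁻¹ * (cform (hess v x) q)⁻¹ * v x * cform (hess v x) q = 1; field_simp)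
    (by change _ = (∑ k, f k * pd k v x) * (v x)⁻¹ * v x; rw [inv_mul_cancel_right₀ hz])
  have hlam : P.lam = lam := by
    change ∑ i, ∑ j, hess v x i j * (f i * f j) = lam
    calc _ = ∑ i, f i * ∑ j, hess v x i j * f j := by
          refine Finset.sum_congr rfl fun i _ => ?_
          rw [Finset.mul_sum]
          exact Finset.sum_congr rfl fun j _ => by ring
      _ = lam * ∑ i, f i ^ 2 := by
          rw [Finset.mul_sum]
          exact Finset.sum_congr rfl fun i _ => by rw [hf i]; ring
      _ = lam := by rw [hunit, mul_one]
  have hsplit : ∑ i, ∑ j, coefAt v x i j * secVar v x f P.T i j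
      = lin (hess v x) (fun k => pd k v x) (v x) (hess₂ v x f)
        + ∑ i, ∑ j, coefMat (hess v x) (fun k => pd k v x) (v x) i j
          * (4 * ∑ k, P.T i k * hess₁ v x f k j
            + 2 * ∑ k, ∑ l, P.T i k * hess v x k l * P.T j l) := by
    simp only [lin, secVar, Matrix.of_apply, mul_add, Finset.sum_add_distrib, coefAt]
  have hV : ∑ k, grad₃ v x f k * P.V k
      = -(2 * v x * gradForm (fun k => pd k v x) (grad₃ v x f) (hess v x)) := by
    change ∑ k, grad₃ v x f k * (-(2 * v x * gradForm (fun k => pd k v x) _ (hess v x))) = _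
    simp only [gradForm, Fin.sum_univ_four]
    simp
    ring
  have hT : P.T = corr P.a P.c (cmul (v x • hess₁ v x f + (∑ k, f k * pd k v x) • hess v x) q) q :=
    rfl
  have hU : P.U = -(2 * v x * gradForm (fun k => pd k v x) f (hess v x))
      * (2 * P.a - 2 * P.c * cform (v x • hess₁ v x f + (∑ k, f k * pd k v x) • hess v x) q)
      - (2 * v x * cdet (hess v x) + gradForm (fun k => pd k v x) (fun k => pd k v x) (hess v x))
      - v x * (2 * P.lam * gradForm f f (hess v x)
        + 4 * gradForm (fun k => pd k v x) f (hess₁ v x f))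
      - 4 * (∑ k, f k * pd k v x) * gradForm (fun k => pd k v x) f (hess v x) := rfl
  rw [hsplit, hV, hU, hlam, hT]
  simp only at hid e1 e2
  rw [hid]
  linear_combination e2 + (2 * P.a - 2 * P.c
    * cform (v x • hess₁ v x f + (∑ k, f k * pd k v x) • hess v x) q) * e1

theorem continuousOn_jetAt (hΩ : IsOpen Ω) (hv : ContDiffOn ℝ 4 v Ω)
    (heq : ∀ y ∈ Ω, opFAt v y = 0) : ContinuousOn (jetAt v) Ω := by
  have hz : ContinuousOn v Ω := hv.continuousOn
  have hp : ∀ k, ContinuousOn (fun y => pd k v y) Ω := fun k =>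
    (contDiffOn_pd (n := 4) (m := 3) hΩ hv le_rfl k).continuousOn
  have hA : ∀ i j, ContinuousOn (fun y => hess v y i j) Ω := fun i j =>
    (contDiffOn_hess hΩ hv i j).continuousOn
  have hD : ∀ i j k, ContinuousOn (fun y => D3 v y i j k) Ω := fun i j k =>
    (contDiffOn_pd (n := 2) (m := 1) hΩ (contDiffOn_hess hΩ hv i j) le_rfl k).continuousOn
  refine hz.prodMk ((hz.inv₀ fun y hy => ne_zero_of_eq (heq y hy)).prodMk
    ((continuousOn_pi.2 hp).prodMk ((continuousOn_pi.2 fun i => continuousOn_pi.2 (hA i)).prodMk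
    ((continuousOn_pi.2 fun i => continuousOn_pi.2 fun j => continuousOn_pi.2 (hD i j)).prodMk ?_))))
  unfold halfTrace
  fun_prop

/-- Near every point of the domain the linearised operator is uniformly elliptic, and the second
variation along eigendirections is controlled by the eigenvalue and its gradient. -/
structure LocalBounds (v : E4 → ℝ) (x₀ : E4) (r θ C : ℝ) : Prop where
  elliptic : ∀ x ∈ Metric.ball x₀ r, ∀ ξ : Fin 4 → ℝ,
    θ * ∑ i, ξ i ^ 2 ≤ ∑ i, ∑ j, coefAt v x i j * (ξ i * ξ j)
  trace : ∀ x ∈ Metric.ball x₀ r, ∑ i, coefAt v x i i ≤ C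
  correction : ∀ x ∈ Metric.ball x₀ r, ∀ (f : Fin 4 → ℝ) (lam : ℝ), ∑ i, f i ^ 2 = 1 →
    (∀ i, ∑ j, hess v x i j * f j = lam * f i) →
    ∃ T : Matrix (Fin 4) (Fin 4) ℝ, (∀ i j, |T i j| ≤ C) ∧
      |∑ i, ∑ j, coefAt v x i j * secVar v x f T i j| ≤ C * (|lam| + ∑ k, |grad₃ v x f k|)

/-- By continuity the jets stay bounded near `x₀`. Since `halfTrace` is part of the jet,
`cform_bounds` also bounds the reciprocal of `cform`, so all data lie in one compact ball. -/
theorem exists_localBounds (hΩ : IsOpen Ω) (hv : ContDiffOn ℝ 4 v Ω)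
    (hpsd : ∀ y ∈ Ω, (hess v y).PosSemidef) (heq : ∀ y ∈ Ω, opFAt v y = 0) {x₀ : E4}
    (hx₀ : x₀ ∈ Ω) :
    ∃ r θ C : ℝ, 0 < r ∧ 0 < θ ∧ 0 < C ∧ Metric.ball x₀ r ⊆ Ω ∧ LocalBounds v x₀ r θ C := by
  have hcont := ((continuousOn_jetAt hΩ hv heq).continuousAt (hΩ.mem_nhds hx₀)).norm
  have hev : ∀ᶠ x in 𝓝 x₀, ‖jetAt v x‖ < ‖jetAt v x₀‖ + 1 :=
    hcont.eventually (gt_mem_nhds (by linarith))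
  obtain ⟨r, hr, hball⟩ := Metric.mem_nhds_iff.1 (hev.and (hΩ.mem_nhds hx₀))
  set M := ‖jetAt v x₀‖ + 1 with hM
  have hM1 : 1 ≤ M := by simp [hM]
  obtain ⟨B, hB⟩ := (isCompact_closedBall (0 : Data) M).exists_bound_of_continuousOn
    Data.continuous_bound.continuousOn
  have hjet : ∀ x ∈ Metric.ball x₀ r, ‖jetAt v x‖ ≤ M := fun x hx => (hball hx).1.le
  have htr : ∀ x ∈ Metric.ball x₀ r, |halfTrace (hess v x) (fun k => pd k v x) (v x)| ≤ M := by
    intro x hx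
    exact (((norm_snd_le _).trans (norm_snd_le _)).trans
      ((norm_snd_le _).trans ((norm_snd_le _).trans (norm_snd_le _)))).trans (hjet x hx)
  have hzinv : ∀ x ∈ Metric.ball x₀ r, |(v x)⁻¹| ≤ M := by
    intro x hx
    exact ((norm_fst_le _).trans (norm_snd_le _)).trans (hjet x hx)
  have hvec : ∀ f : Fin 4 → ℝ, ∑ i, f i ^ 2 = 1 → ‖f‖ ≤ M := by
    intro f hf
    refine le_trans ((pi_norm_le_iff_of_nonneg zero_le_one).2 fun i => ?_) hM1
    have : f i ^ 2 ≤ 1 := by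
      rw [← hf]
      exact Finset.single_le_sum (f := fun i => f i ^ 2) (fun j _ => sq_nonneg _)
        (Finset.mem_univ i)
    rwa [Real.norm_eq_abs, ← sq_le_one_iff_abs_le_one]
  have hMB : 0 < 2 * M + |B| := by positivity
  -- In the ellipticity estimate, two factors `M` come from `|v⁻¹| ≤ M` and one from `halfTrace ≤
  -- M`; the trace of the coefficients is twice `halfTrace`.
  refine ⟨r, (M ^ 3)⁻¹, 2 * M + |B|, hr, by positivity, hMB, fun x hx => (hball hx).2,
    ⟨?_, ?_, ?_⟩⟩
  · intro x hx ξ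
    have hxΩ := (hball hx).2
    obtain ⟨q, κ, hq, -, hκ⟩ := exists_isPerp fun k => pd k v x
    obtain ⟨hg, ht, -⟩ := cform_bounds (hpsd x hxΩ) (heq x hxΩ) hq hκ
    have hell := coefMat_elliptic (isSymm_hess hpsd hxΩ) (heq x hxΩ) ξ
    have htM := (le_abs_self _).trans (htr x hx)
    have hz : v x ≠ 0 := ne_zero_of_eq (heq x hxΩ)
    have hzM : 1 ≤ M ^ 2 * v x ^ 2 := by
      have := hzinv x hx
      rw [abs_inv, inv_le_iff_one_le_mul₀ (abs_pos.2 hz)] at this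
      rw [← sq_abs (v x), ← mul_pow]
      exact one_le_pow₀ this
    set S := ∑ i, ξ i ^ 2 with hS
    have hS0 : 0 ≤ S := Finset.sum_nonneg fun i _ => sq_nonneg _
    change _ ≤ ∑ i, ∑ j, coefMat (hess v x) (fun k => pd k v x) (v x) i j * (ξ i * ξ j)
    set G := ∑ i, ∑ j, coefMat (hess v x) (fun k => pd k v x) (v x) i j * (ξ i * ξ j) with hG
    have hG0 : 0 ≤ G := by
      by_contra! hneg
      nlinarith [mul_nonneg (sq_nonneg (v x)) hS0]
    rw [inv_mul_le_iff₀ (by positivity)]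
    calc S ≤ (M ^ 2 * v x ^ 2) * S := le_mul_of_one_le_left hS0 hzM
      _ = M ^ 2 * (v x ^ 2 * S) := by ring
      _ ≤ M ^ 2 * (M * G) :=
          mul_le_mul_of_nonneg_left (hell.trans (mul_le_mul_of_nonneg_right htM hG0)) (sq_nonneg M)
      _ = M ^ 3 * G := by ring
  · intro x hx
    rw [coefAt, trace_coefMat]
    linarith [(le_abs_self _).trans (htr x hx), abs_nonneg B]
  · intro x hx f lam hunit hf
    have hxΩ := (hball hx).2
    obtain ⟨q, κ, hq, -, hκ⟩ := exists_isPerp fun k => pd k v x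
    obtain ⟨hg, ht, hgt⟩ := cform_bounds (hpsd x hxΩ) (heq x hxΩ) hq hκ
    set P : Data := (jetAt v x, f, q, (cform (hess v x) q)⁻¹) with hP
    have hPM : ‖P‖ ≤ M := by
      refine norm_prod_le_iff.2 ⟨hjet x hx, norm_prod_le_iff.2 ⟨hvec f hunit,
        norm_prod_le_iff.2 ⟨hvec q hq.unit, ?_⟩⟩⟩
      change |(cform (hess v x) q)⁻¹| ≤ M
      rw [abs_of_pos (inv_pos.2 hg)]
      exact hgt.trans ((le_abs_self _).trans (htr x hx))
    have hbd := (le_abs_self _).trans (hB P (by simpa using hPM))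
    have hT0 : ∀ i, 0 ≤ ∑ j, |P.T i j| := fun i => Finset.sum_nonneg fun j _ => abs_nonneg _
    have hT0' : 0 ≤ ∑ i, ∑ j, |P.T i j| := Finset.sum_nonneg fun i _ => hT0 i
    have hV0 : 0 ≤ ∑ k, |P.V k| := Finset.sum_nonneg fun i _ => abs_nonneg _
    have hBB : B ≤ 2 * M + |B| := by linarith [le_abs_self B]
    refine ⟨P.T, fun i j => ?_, ?_⟩
    · have h1 : |P.T i j| ≤ ∑ j, |P.T i j| :=
        Finset.single_le_sum (f := fun j => |P.T i j|) (fun _ _ => abs_nonneg _) (Finset.mem_univ j)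
      have h2 : ∑ j, |P.T i j| ≤ ∑ i, ∑ j, |P.T i j| :=
        Finset.single_le_sum (f := fun i => ∑ j, |P.T i j|) (fun i _ => hT0 i) (Finset.mem_univ i)
      linarith [abs_nonneg P.U]
    · rw [contraction_eq hΩ hv hpsd heq hxΩ hunit hf hq hg.ne', mul_add]
      refine (abs_add_le _ _).trans (add_le_add ?_ ?_)
      · rw [abs_mul, mul_comm]
        gcongr
        linarith
      · rw [Finset.mul_sum]
        refine (Finset.abs_sum_le_sum_abs _ _).trans (Finset.sum_le_sum fun k _ => ?_)
        rw [abs_mul, mul_comm]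
        gcongr
        have : |P.V k| ≤ ∑ k, |P.V k| :=
          Finset.single_le_sum (f := fun k => |P.V k|) (fun _ _ => abs_nonneg _) (Finset.mem_univ k)
        linarith [abs_nonneg P.U]

end Solution

end ConstRank

/-! ### Quadratic forms and the second variation -/

namespace ConstRank

theorem form_comm {A : Matrix (Fin 4) (Fin 4) ℝ} (hA : A.IsSymm) (a b : Fin 4 → ℝ) :
    form A a b = form A b a := by
  unfold form
  rw [Finset.sum_comm]
  refine Finset.sum_congr rfl fun i _ => Finset.sum_congr rfl fun j _ => ?_
  rw [hA.apply i j, mul_comm (a j)]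

theorem form_add_left (A : Matrix (Fin 4) (Fin 4) ℝ) (a b c : Fin 4 → ℝ) :
    form A (a + b) c = form A a c + form A b c := by
  simp only [form, Pi.add_apply, add_mul, mul_add, Finset.sum_add_distrib]

theorem form_add_right (A : Matrix (Fin 4) (Fin 4) ℝ) (a b c : Fin 4 → ℝ) :
    form A a (b + c) = form A a b + form A a c := by
  simp only [form, Pi.add_apply, mul_add, Finset.sum_add_distrib]

theorem form_smul_left (A : Matrix (Fin 4) (Fin 4) ℝ) (s : ℝ) (a b : Fin 4 → ℝ) :
    form A (s • a) b = s * form A a b := by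
  simp only [form, Pi.smul_apply, smul_eq_mul, Finset.mul_sum]
  exact Finset.sum_congr rfl fun i _ => Finset.sum_congr rfl fun j _ => by ring

theorem form_smul_right (A : Matrix (Fin 4) (Fin 4) ℝ) (s : ℝ) (a b : Fin 4 → ℝ) :
    form A a (s • b) = s * form A a b := by
  simp only [form, Pi.smul_apply, smul_eq_mul, Finset.mul_sum]
  exact Finset.sum_congr rfl fun i _ => Finset.sum_congr rfl fun j _ => by ring

theorem form_eigen {A : Matrix (Fin 4) (Fin 4) ℝ} (hA : A.IsSymm) {f : Fin 4 → ℝ} {lam : ℝ}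
    (hf : ∀ i, ∑ j, A i j * f j = lam * f i) (a : Fin 4 → ℝ) :
    form A f a = lam * ∑ i, f i * a i := by
  rw [form_comm hA, form, Finset.mul_sum]
  refine Finset.sum_congr rfl fun i _ => ?_
  calc _ = a i * ∑ j, A i j * f j := by
        rw [Finset.mul_sum]; exact Finset.sum_congr rfl fun j _ => by ring
    _ = _ := by rw [hf]; ring

theorem eq_zero_of_quadratic_nonneg {b c : ℝ} (h : ∀ t : ℝ, 0 ≤ t * b + t ^ 2 * c) : b = 0 := by
  have hj : HasJet (fun t => t * b + t * t * c) 0 b (2 * c) :=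
    ((HasJet.id.mul (.const b)).add ((HasJet.id.mul .id).mul (.const c))).congr (by ring) (by ring)
      (by ring)
  exact (hj.of_nonneg (.of_forall fun t => by simpa [sq] using h t)).1

/-- A minimiser of the Rayleigh quotient is an eigenvector. -/
theorem eigen_of_isMin {A : Matrix (Fin 4) (Fin 4) ℝ} (hA : A.IsSymm) {f : Fin 4 → ℝ} {lam : ℝ}
    (hf : form A f f = lam * ∑ i, f i ^ 2) (h : ∀ g, lam * ∑ i, g i ^ 2 ≤ form A g g) :
    ∀ i, ∑ j, A i j * f j = lam * f i := by
  have key : ∀ g, form A f g - lam * ∑ i, f i * g i = 0 := by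
    intro g
    have := eq_zero_of_quadratic_nonneg (b := 2 * (form A f g - lam * ∑ i, f i * g i))
      (c := form A g g - lam * ∑ i, g i ^ 2) (fun t => by
        have ht := h (f + t • g)
        simp only [form_add_left, form_add_right, form_smul_left, form_smul_right,
          form_comm hA g f] at ht
        have e : ∑ i, (f + t • g) i ^ 2
            = ∑ i, f i ^ 2 + 2 * t * ∑ i, f i * g i + t ^ 2 * ∑ i, g i ^ 2 := by
          simp only [Fin.sum_univ_four, Pi.add_apply, Pi.smul_apply, smul_eq_mul]
          ring
        rw [e] at ht
        nlinarith)
    linarith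
  intro i
  have := key (Pi.single i 1)
  rw [form_comm hA] at this
  simp only [form] at this
  simp [Pi.single_apply] at this
  linarith

/-- A positive semidefinite matrix is a sum of squares, in terms of contractions. -/
theorem exists_contraction {a : Matrix (Fin 4) (Fin 4) ℝ} (ha : a.IsSymm)
    (hpos : ∀ ξ : Fin 4 → ℝ, 0 ≤ ∑ i, ∑ j, a i j * (ξ i * ξ j)) :
    ∃ B : Matrix (Fin 4) (Fin 4) ℝ, ∀ N : Matrix (Fin 4) (Fin 4) ℝ,
      ∑ i, ∑ j, a i j * N i j = ∑ k, form N (B k) (B k) := by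
  have hps : a.PosSemidef := by
    refine Matrix.PosSemidef.of_dotProduct_mulVec_nonneg ?_ fun ξ => ?_
    · simpa [Matrix.IsHermitian, Matrix.IsSymm] using ha
    · have := hpos ξ
      simp only [dotProduct, Matrix.mulVec, Pi.star_apply, star_trivial, Finset.mul_sum]
      simpa only [mul_left_comm] using this
  obtain ⟨B, hB⟩ : ∃ B : Matrix (Fin 4) (Fin 4) ℝ, a = B.conjTranspose * B := by
    open scoped MatrixOrder in
    exact (CStarAlgebra.nonneg_iff_eq_star_mul_self (a := a)).1 hps.nonneg
  refine ⟨B, fun N => ?_⟩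
  simp only [hB, form, Matrix.mul_apply, Matrix.conjTranspose_apply, star_trivial,
    Fin.sum_univ_four]
  ring

theorem contraction_le {a N : Matrix (Fin 4) (Fin 4) ℝ} (ha : a.IsSymm)
    (hpos : ∀ ξ : Fin 4 → ℝ, 0 ≤ ∑ i, ∑ j, a i j * (ξ i * ξ j)) {K : ℝ}
    (h : ∀ d : Fin 4 → ℝ, form N d d ≤ K * ∑ i, d i ^ 2) :
    ∑ i, ∑ j, a i j * N i j ≤ K * ∑ i, a i i := by
  obtain ⟨B, hB⟩ := exists_contraction ha hpos
  have h1 : ∑ i, a i i = ∑ k, ∑ i, B k i ^ 2 := by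
    have := hB 1
    simpa [form, Matrix.one_apply, sq] using this
  rw [hB, h1, Finset.mul_sum]
  exact Finset.sum_le_sum fun k _ => h (B k)

theorem isSymm_coefAt (v : E4 → ℝ) (x : E4) : (coefAt v x).IsSymm := by
  ext i j
  fin_cases i <;> fin_cases j <;> simp [coefAt, coefMat]

section Solution

variable {Ω : Set E4} {v : E4 → ℝ} {x : E4}

/-- The direction `T(d)`, where the rows of `T` are the images of the basis vectors. -/
def rowComb (d : Fin 4 → ℝ) (T : Matrix (Fin 4) (Fin 4) ℝ) (k : Fin 4) : ℝ := ∑ i, d i * T i k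

/-- Symmetry of third and fourth derivatives exchanges `f` and `d`. Thus `secVar`, built from
derivatives along `f`, is at `d` the second derivative of the Hessian form on the moving vector `f +
t • rowComb d T` along `d`. This links the differentiated equation to the eigenvalue tests. -/
theorem form_secVar (hΩ : IsOpen Ω) (hv : ContDiffOn ℝ 4 v Ω) (hx : x ∈ Ω) (f d : Fin 4 → ℝ)
    (T : Matrix (Fin 4) (Fin 4) ℝ) :
    form (secVar v x f T) d d = form (hess₂ v x d) f f + 4 * form (hess₁ v x d) f (rowComb d T)
      + 2 * form (hess v x) (rowComb d T) (rowComb d T) := by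
  have e1 : form (hess₂ v x f) d d = form (hess₂ v x d) f f := by
    simp only [form, hess₂, Matrix.of_apply, Finset.sum_mul]
    calc _ = ∑ i, ∑ j, ∑ k, ∑ l, f k * f l * D4 v x k l i j * (d i * d j) := by
          simp only [← D4_comm hΩ hv hx]
      _ = _ := by
          simp only [Fin.sum_univ_four]
          ring
  have e2 : form (Matrix.of fun i j => ∑ k, T i k * hess₁ v x f k j) d d
      = form (hess₁ v x d) f (rowComb d T) := by
    have h3 : ∀ k j l, D3 v x k j l = D3 v x l k j := fun k j l => by
      rw [D3_comm₂ hΩ hv hx, D3_comm₁ hΩ hv hx]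
    simp only [form, hess₁, rowComb, Matrix.of_apply]
    calc _ = ∑ i, ∑ j, (∑ k, T i k * ∑ l, f l * D3 v x l k j) * (d i * d j) := by
          simp only [← h3]
      _ = _ := by
          simp only [Fin.sum_univ_four]
          ring
  have e3 : form (Matrix.of fun i j => ∑ k, ∑ l, T i k * hess v x k l * T j l) d d
      = form (hess v x) (rowComb d T) (rowComb d T) := by
    generalize hess v x = A
    simp only [form, rowComb, Matrix.of_apply, Fin.sum_univ_four]
    ring
  rw [← e1, ← e2, ← e3]
  simp only [form, secVar, Matrix.of_apply, add_mul, mul_assoc, Finset.sum_add_distrib,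
    ← Finset.mul_sum]
  ring

theorem hasJet_form (hΩ : IsOpen Ω) (hv : ContDiffOn ℝ 4 v Ω)
    (hpsd : ∀ y ∈ Ω, (hess v y).PosSemidef) (hx : x ∈ Ω) (d e τ : Fin 4 → ℝ) :
    HasJet (fun t => form (hess v (x + t • vec d)) (e + t • τ) (e + t • τ))
      (form (hess v x) e e) (form (hess₁ v x d) e e + 2 * form (hess v x) e τ)
      (form (hess₂ v x d) e e + 4 * form (hess₁ v x d) e τ + 2 * form (hess v x) τ τ) := by
  have hj : ∀ i, HasJet (fun t => (e + t • τ) i) (e i) (τ i) 0 := fun i => by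
    simpa using HasJet.affine (e i) (τ i)
  have := HasJet.sum (s := Finset.univ) fun i _ => HasJet.sum (s := Finset.univ) fun j _ =>
    (hasJet_hess hΩ hv hx d i j).mul ((hj i).mul (hj j))
  refine this.congr rfl ?_ ?_
  · rw [show 2 * form (hess v x) e τ = form (hess v x) e τ + form (hess v x) τ e by
      rw [form_comm (isSymm_hess hpsd hx) τ]; ring]
    simp only [form, ← Finset.sum_add_distrib]
    exact Finset.sum_congr rfl fun i _ => Finset.sum_congr rfl fun j _ => by ring
  · rw [show 4 * form (hess₁ v x d) e τ = 2 * form (hess₁ v x d) e τ + 2 * form (hess₁ v x d) τ e by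
      rw [form_comm (isSymm_hess₁ hΩ hv hx d) τ]; ring]
    simp only [form, Finset.mul_sum, ← Finset.sum_add_distrib]
    exact Finset.sum_congr rfl fun i _ => Finset.sum_congr rfl fun j _ => by ring

theorem form_hess₁_self (hΩ : IsOpen Ω) (hv : ContDiffOn ℝ 4 v Ω) (hx : x ∈ Ω)
    (d f : Fin 4 → ℝ) : form (hess₁ v x d) f f = ∑ k, d k * grad₃ v x f k := by
  have h3 : ∀ i j k, D3 v x i j k = D3 v x k i j := fun k j l => by
    rw [D3_comm₂ hΩ hv hx, D3_comm₁ hΩ hv hx]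
  simp only [form, hess₁, grad₃, Matrix.of_apply]
  calc _ = ∑ i, ∑ j, (∑ k, d k * D3 v x k i j) * (f i * f j) := by simp only [← h3]
    _ = _ := by
      simp only [Fin.sum_univ_four]
      ring

/-- Identifies `grad₃` with the slope of a touching quadratic, so that the error in
`LocalBounds.correction` becomes the gradient term of the minimum principle. -/
theorem grad₃_eq_of_form (hΩ : IsOpen Ω) (hv : ContDiffOn ℝ 4 v Ω) (hx : x ∈ Ω)
    {f b : Fin 4 → ℝ} (h : ∀ d, form (hess₁ v x d) f f = ∑ i, b i * d i) : grad₃ v x f = b := by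
  funext k
  have := h (Pi.single k 1)
  rw [form_hess₁_self hΩ hv hx] at this
  simpa [Pi.single_apply] using this

end Solution

theorem sq_norm_le_sum {d : Fin 4 → ℝ} : ‖d‖ ^ 2 ≤ ∑ i, d i ^ 2 := by
  obtain ⟨i, hi⟩ : ∃ i, ‖d‖ = |d i| := by
    obtain ⟨i, -, hi⟩ := Finset.exists_max_image Finset.univ (fun i => |d i|) Finset.univ_nonempty
    refine ⟨i, le_antisymm ((pi_norm_le_iff_of_nonneg (abs_nonneg _)).2 fun j => hi j
      (Finset.mem_univ j)) (norm_le_pi_norm d i)⟩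
  rw [hi, sq_abs]
  exact Finset.single_le_sum (f := fun i => d i ^ 2) (fun j _ => sq_nonneg _) (Finset.mem_univ i)

theorem norm_le_one_of_unit {f : Fin 4 → ℝ} (hf : ∑ i, f i ^ 2 = 1) : ‖f‖ ≤ 1 := by
  have := sq_norm_le_sum (d := f)
  rw [hf] at this
  exact (sq_le_one_iff₀ (norm_nonneg _)).1 this

theorem abs_dot_le {a b : Fin 4 → ℝ} : |∑ i, a i * b i| ≤ (∑ i, |a i|) * ‖b‖ := by
  rw [Finset.sum_mul]
  refine (Finset.abs_sum_le_sum_abs _ _).trans (Finset.sum_le_sum fun i _ => ?_)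
  rw [abs_mul]
  gcongr
  exact norm_le_pi_norm b i

theorem sum_abs_le {a : Fin 4 → ℝ} : ∑ i, |a i| ≤ 4 * ‖a‖ := by
  calc _ ≤ ∑ _i : Fin 4, ‖a‖ := Finset.sum_le_sum fun i _ => norm_le_pi_norm a i
    _ = 4 * ‖a‖ := by simp

theorem abs_dot_le_norm {a b : Fin 4 → ℝ} : |∑ i, a i * b i| ≤ 4 * ‖a‖ * ‖b‖ :=
  abs_dot_le.trans (by gcongr; exact sum_abs_le)

theorem norm_rowComb_le {T : Matrix (Fin 4) (Fin 4) ℝ} {C : ℝ} (hT : ∀ i j, |T i j| ≤ C)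
    (d : Fin 4 → ℝ) : ‖rowComb d T‖ ≤ 4 * C * ‖d‖ := by
  have hC : 0 ≤ C := (abs_nonneg _).trans (hT 0 0)
  refine (pi_norm_le_iff_of_nonneg (by positivity)).2 fun k => ?_
  refine (abs_dot_le_norm (a := d) (b := fun i => T i k)).trans ?_
  have : ‖fun i => T i k‖ ≤ C := (pi_norm_le_iff_of_nonneg hC).2 fun i => hT i k
  calc 4 * ‖d‖ * ‖fun i => T i k‖ ≤ 4 * ‖d‖ * C := by gcongr
    _ = _ := by ring

end ConstRank

/-! ### The lowest eigenvalue -/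

namespace ConstRank

section Minimum

variable {α : Type*} [TopologicalSpace α] {K : Set α}
  {F : Matrix (Fin 4) (Fin 4) ℝ → α → ℝ}

theorem exists_eq_sInf (hK : IsCompact K) (hne : K.Nonempty) (hF : ∀ A, Continuous (F A))
    (A : Matrix (Fin 4) (Fin 4) ℝ) : ∃ f ∈ K, F A f = sInf (F A '' K) := by
  obtain ⟨f, hf, h⟩ := hK.exists_sInf_image_eq hne (hF A).continuousOn
  exact ⟨f, hf, h.symm⟩

theorem sInf_le_of_mem (hK : IsCompact K) (hF : ∀ A, Continuous (F A))
    (A : Matrix (Fin 4) (Fin 4) ℝ) {f : α} (hf : f ∈ K) : sInf (F A '' K) ≤ F A f :=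
  csInf_le (hK.image (hF A)).bddBelow ⟨f, hf, rfl⟩

end Minimum

/-- The Euclidean unit sphere. -/
def unitSphere : Set (Fin 4 → ℝ) := {f | ∑ i, f i ^ 2 = 1}

theorem isCompact_unitSphere : IsCompact unitSphere := by
  refine (isCompact_closedBall (0 : Fin 4 → ℝ) 1).of_isClosed_subset
    (isClosed_eq (by fun_prop) continuous_const) fun f hf => ?_
  simpa using norm_le_one_of_unit hf

theorem unitSphere_nonempty : unitSphere.Nonempty :=
  ⟨Pi.single 0 1, by simp [unitSphere, Pi.single_apply]⟩

theorem continuous_form : Continuous fun P : Matrix (Fin 4) (Fin 4) ℝ × (Fin 4 → ℝ) =>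
    form P.1 P.2 P.2 := by
  unfold form
  fun_prop

theorem continuous_form_right (A : Matrix (Fin 4) (Fin 4) ℝ) :
    Continuous fun f : Fin 4 → ℝ => form A f f :=
  continuous_form.comp (by fun_prop : Continuous fun f : Fin 4 → ℝ => (A, f))

/-- The lowest eigenvalue of a symmetric matrix. -/
noncomputable def lowest (A : Matrix (Fin 4) (Fin 4) ℝ) : ℝ :=
  sInf ((fun f => form A f f) '' unitSphere)

theorem continuous_lowest : Continuous lowest :=
  isCompact_unitSphere.continuous_sInf continuous_form

theorem exists_form_eq_lowest (A : Matrix (Fin 4) (Fin 4) ℝ) :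
    ∃ f : Fin 4 → ℝ, ∑ i, f i ^ 2 = 1 ∧ form A f f = lowest A :=
  exists_eq_sInf isCompact_unitSphere unitSphere_nonempty continuous_form_right A

theorem exists_smul_unit (g : Fin 4 → ℝ) :
    ∃ (s : ℝ) (f : Fin 4 → ℝ), g = s • f ∧ ∑ i, f i ^ 2 = 1 := by
  by_cases h : ∑ i, g i ^ 2 = 0
  · obtain ⟨f, hf⟩ := unitSphere_nonempty
    refine ⟨0, f, ?_, hf⟩
    funext i
    have := (Finset.sum_eq_zero_iff_of_nonneg (fun i _ => sq_nonneg (g i))).1 h i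
      (Finset.mem_univ i)
    simpa using this
  · have hpos : 0 < ∑ i, g i ^ 2 :=
      lt_of_le_of_ne (Finset.sum_nonneg fun i _ => sq_nonneg _) (Ne.symm h)
    have hs := Real.sqrt_pos.2 hpos
    refine ⟨√(∑ i, g i ^ 2), (√(∑ i, g i ^ 2))⁻¹ • g, (smul_inv_smul₀ hs.ne' g).symm, ?_⟩
    simp only [Pi.smul_apply, smul_eq_mul, mul_pow, ← Finset.mul_sum, inv_pow,
      Real.sq_sqrt hpos.le]
    exact inv_mul_cancel₀ h

theorem lowest_mul_le (A : Matrix (Fin 4) (Fin 4) ℝ) (g : Fin 4 → ℝ) :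
    lowest A * ∑ i, g i ^ 2 ≤ form A g g := by
  obtain ⟨s, f, rfl, hf⟩ := exists_smul_unit g
  have : lowest A ≤ form A f f := sInf_le_of_mem isCompact_unitSphere continuous_form_right A hf
  simp only [form_smul_left, form_smul_right, Pi.smul_apply, smul_eq_mul, mul_pow,
    ← Finset.mul_sum, hf]
  nlinarith [sq_nonneg s]

theorem lowest_nonneg {A : Matrix (Fin 4) (Fin 4) ℝ} (hA : A.PosSemidef) : 0 ≤ lowest A := by
  obtain ⟨f, -, hf⟩ := exists_form_eq_lowest A
  rw [← hf]
  exact form_nonneg hA f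

section Solution

variable {Ω : Set E4} {v : E4 → ℝ} {x : E4}

theorem hasJet_quadratic (a b c : ℝ) : HasJet (fun t => a + t * b + t * t * (c / 2)) a b c :=
  ((HasJet.affine a b).add ((HasJet.id.mul .id).mul (.const (c / 2)))).congr (by ring) (by ring)
    (by ring)

theorem hasJet_sum_sq (e τ : Fin 4 → ℝ) :
    HasJet (fun t => ∑ i, (e + t • τ) i ^ 2) (∑ i, e i ^ 2) (2 * ∑ i, e i * τ i)
      (2 * ∑ i, τ i ^ 2) := by
  have hj : ∀ i, HasJet (fun t => (e + t • τ) i) (e i) (τ i) 0 := fun i => by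
    simpa using HasJet.affine (e i) (τ i)
  have := HasJet.sum (s := Finset.univ) fun i _ => (hj i).mul (hj i)
  simp only [← sq] at this
  refine this.congr rfl ?_ ?_
  · rw [Finset.mul_sum]
    exact Finset.sum_congr rfl fun i _ => by ring
  · rw [Finset.mul_sum]
    exact Finset.sum_congr rfl fun i _ => by ring

/-- First and second order conditions when a quadratic touches the lowest eigenvalue from below
along a line, tested with the field `f + t τ`. -/
theorem one_field_test (hΩ : IsOpen Ω) (hv : ContDiffOn ℝ 4 v Ω)
    (hpsd : ∀ y ∈ Ω, (hess v y).PosSemidef) (hx : x ∈ Ω) {d f : Fin 4 → ℝ} {lam β γ : ℝ}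
    (hunit : ∑ i, f i ^ 2 = 1) (hf : ∀ i, ∑ j, hess v x i j * f j = lam * f i)
    (h : ∀ᶠ t in 𝓝 (0 : ℝ), ∀ g : Fin 4 → ℝ,
      (lam + t * β + t * t * (γ / 2)) * ∑ i, g i ^ 2 ≤ form (hess v (x + t • vec d)) g g)
    (τ : Fin 4 → ℝ) :
    form (hess₁ v x d) f f = β ∧
    γ ≤ form (hess₂ v x d) f f + 4 * form (hess₁ v x d) f τ + 2 * form (hess v x) τ τ
      - 4 * β * ∑ i, f i * τ i - 2 * lam * ∑ i, τ i ^ 2 := by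
  have hj := (hasJet_form hΩ hv hpsd hx d f τ).sub
    ((hasJet_quadratic lam β γ).mul (hasJet_sum_sq f τ))
  have hff : form (hess v x) f f = lam := by
    rw [form_eigen (isSymm_hess hpsd hx) hf]
    simp only [← sq, hunit, mul_one]
  have hfτ := form_eigen (isSymm_hess hpsd hx) hf τ
  obtain ⟨h1, h2⟩ := (hj.congr (by rw [hff, hunit]; ring) rfl rfl).of_nonneg (by
    filter_upwards [h] with t ht
    linarith [ht (f + t • τ)])
  rw [hfτ, hunit] at h1
  rw [hunit] at h2
  exact ⟨by linarith, by linarith⟩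

theorem eventually_line_le {w : E4 → ℝ} {b : Fin 4 → ℝ} {Q : Matrix (Fin 4) (Fin 4) ℝ}
    (h : ∀ᶠ y in 𝓝 x, w x + ∑ i, b i * (y i - x i)
        + (1 / 2) * ∑ i, ∑ j, Q i j * ((y i - x i) * (y j - x j)) ≤ w y) (d : Fin 4 → ℝ) :
    ∀ᶠ t in 𝓝 (0 : ℝ), w x + t * ∑ i, b i * d i + t * t * (form Q d d / 2)
      ≤ w (x + t • vec d) := by
  have hc : Continuous fun t : ℝ => x + t • vec d := by fun_prop
  have h' : ∀ᶠ y in 𝓝 (x + (0 : ℝ) • vec d), w x + ∑ i, b i * (y i - x i)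
        + (1 / 2) * ∑ i, ∑ j, Q i j * ((y i - x i) * (y j - x j)) ≤ w y := by simpa using h
  filter_upwards [hc.continuousAt.eventually h'] with t ht
  refine le_of_eq_of_le ?_ ht
  have e1 : ∑ i, b i * ((x + t • vec d) i - x i) = t * ∑ i, b i * d i := by
    rw [Finset.mul_sum]
    exact Finset.sum_congr rfl fun i _ => by simp; ring
  have e2 : ∑ i, ∑ j, Q i j * (((x + t • vec d) i - x i) * ((x + t • vec d) j - x j))
      = t * t * form Q d d := by
    simp only [form, Finset.mul_sum]
    exact Finset.sum_congr rfl fun i _ => Finset.sum_congr rfl fun j _ => by simp; ring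
  rw [e1, e2]
  ring

theorem form_nonneg_of_elliptic {x₀ : E4} {r θ C : ℝ} (hθ : 0 < θ)
    (hb : LocalBounds v x₀ r θ C) (hx : x ∈ Metric.ball x₀ r) (ξ : Fin 4 → ℝ) :
    0 ≤ ∑ i, ∑ j, coefAt v x i j * (ξ i * ξ j) :=
  le_trans (mul_nonneg hθ.le (Finset.sum_nonneg fun _ _ => sq_nonneg _)) (hb.elliptic x hx ξ)

/-- If the lowest eigenvalue of the Hessian vanishes at a point, it vanishes nearby. -/
theorem lowest_eq_zero (hΩ : IsOpen Ω) (hv : ContDiffOn ℝ 4 v Ω)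
    (hpsd : ∀ y ∈ Ω, (hess v y).PosSemidef) {x₀ : E4} {r θ C : ℝ} (hr : 0 < r) (hθ : 0 < θ)
    (hC : 0 < C) (hsub : Metric.ball x₀ r ⊆ Ω) (hb : LocalBounds v x₀ r θ C)
    (h0 : lowest (hess v x₀) = 0) :
    ∀ y ∈ Metric.ball x₀ (r / 4), lowest (hess v y) = 0 := by
  have hCC : C ≤ C + 64 * C ^ 2 := by nlinarith [sq_nonneg C]
  refine strong_minimum_principle (w := fun y => lowest (hess v y)) (a := coefAt v) (θ := θ)
    (C := C + 64 * C ^ 2) hr hθ (by positivity) ?_ (fun y hy => lowest_nonneg (hpsd y (hsub hy)))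
    h0 hb.elliptic (fun x hx => (hb.trace x hx).trans hCC) ?_
  · refine continuous_lowest.comp_continuousOn ?_
    exact continuousOn_pi.2 fun i => continuousOn_pi.2 fun j =>
      ((contDiffOn_hess hΩ hv i j).continuousOn).mono hsub
  · intro x hx b Q hQ
    have hxΩ := hsub hx
    have hsymm := isSymm_hess hpsd hxΩ
    obtain ⟨f, hunit, hflow⟩ := exists_form_eq_lowest (hess v x)
    set lam := lowest (hess v x) with hlam
    have hlam0 : 0 ≤ lam := lowest_nonneg (hpsd x hxΩ)
    have hf := eigen_of_isMin hsymm (by rw [hflow, hunit, mul_one]) (lowest_mul_le (hess v x))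
    obtain ⟨T, hT, hN⟩ := hb.correction x hx f lam hunit hf
    -- The test field `f + t • rowComb d T` is used in every direction `d` at once; its second
    -- variation is then the quadratic form of the single matrix `secVar`.
    have htest : ∀ d, form (hess₁ v x d) f f = ∑ i, b i * d i ∧
        form Q d d ≤ form (secVar v x f T) d d
          - 4 * (∑ i, b i * d i) * ∑ i, f i * rowComb d T i
          - 2 * lam * ∑ i, rowComb d T i ^ 2 := by
      intro d
      rw [form_secVar hΩ hv hxΩ]
      refine one_field_test hΩ hv hpsd hxΩ hunit hf ?_ (rowComb d T)
      filter_upwards [eventually_line_le (w := fun y => lowest (hess v y)) hQ d] with t ht g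
      exact (mul_le_mul_of_nonneg_right ht (Finset.sum_nonneg fun _ _ => sq_nonneg _)).trans
        (lowest_mul_le _ g)
    have hgrad := grad₃_eq_of_form hΩ hv hxΩ fun d => (htest d).1
    have hS : 0 ≤ ∑ i, |b i| := Finset.sum_nonneg fun _ _ => abs_nonneg _
    -- Only the normalisation of the test vector costs anything: 4 times the slope times `16 * C *
    -- ‖d‖`. The other term has a favourable sign because `lam ≥ 0`.
    have hdir : ∀ d, form (Q - secVar v x f T) d d ≤ (64 * C * ∑ i, |b i|) * ∑ i, d i ^ 2 := by
      intro d
      have h1 := (htest d).2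
      have h2 : |∑ i, b i * d i| ≤ (∑ i, |b i|) * ‖d‖ := abs_dot_le
      have h3 : |∑ i, f i * rowComb d T i| ≤ 16 * C * ‖d‖ := by
        refine abs_dot_le_norm.trans ?_
        calc 4 * ‖f‖ * ‖rowComb d T‖ ≤ 4 * 1 * (4 * C * ‖d‖) := by
              gcongr
              · exact norm_le_one_of_unit hunit
              · exact norm_rowComb_le hT d
          _ = _ := by ring
      have h4 : |(∑ i, b i * d i) * ∑ i, f i * rowComb d T i|
          ≤ ((∑ i, |b i|) * ‖d‖) * (16 * C * ‖d‖) := by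
        rw [abs_mul]
        gcongr
      have h5 := (abs_le.1 h4).1
      have h6 : 0 ≤ lam * ∑ i, rowComb d T i ^ 2 :=
        mul_nonneg hlam0 (Finset.sum_nonneg fun _ _ => sq_nonneg _)
      have h7 : (64 * C * ∑ i, |b i|) * ‖d‖ ^ 2 ≤ (64 * C * ∑ i, |b i|) * ∑ i, d i ^ 2 := by
        gcongr
        exact sq_norm_le_sum
      have h8 : form (Q - secVar v x f T) d d = form Q d d - form (secVar v x f T) d d := by
        simp only [form, Matrix.sub_apply, sub_mul, Finset.sum_sub_distrib]
      rw [h8]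
      nlinarith
    have hcon := contraction_le (isSymm_coefAt v x) (form_nonneg_of_elliptic hθ hb hx) hdir
    have hsplit : ∑ i, ∑ j, coefAt v x i j * (Q - secVar v x f T) i j
        = ∑ i, ∑ j, coefAt v x i j * Q i j - ∑ i, ∑ j, coefAt v x i j * secVar v x f T i j := by
      simp only [Matrix.sub_apply, mul_sub, Finset.sum_sub_distrib]
    rw [hsplit] at hcon
    have htr : (64 * C * ∑ i, |b i|) * ∑ i, coefAt v x i i ≤ (64 * C * ∑ i, |b i|) * C := by
      gcongr
      exact hb.trace x hx
    have hN' := (abs_le.1 hN).2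
    rw [hgrad, abs_of_nonneg hlam0] at hN'
    change _ ≤ _ * (lam + _)
    nlinarith [mul_nonneg (sq_nonneg C) hlam0]

end Solution

end ConstRank

/-! ### The sum of the two lowest eigenvalues -/

namespace ConstRank

/-- Orthonormal pairs of vectors. -/
def orthonormalPairs : Set ((Fin 4 → ℝ) × (Fin 4 → ℝ)) :=
  {P | ∑ i, P.1 i ^ 2 = 1 ∧ ∑ i, P.2 i ^ 2 = 1 ∧ ∑ i, P.1 i * P.2 i = 0}

theorem isCompact_orthonormalPairs : IsCompact orthonormalPairs := by
  refine (isCompact_closedBall (0 : (Fin 4 → ℝ) × (Fin 4 → ℝ)) 1).of_isClosed_subset ?_ ?_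
  · exact (isClosed_eq (by fun_prop) continuous_const).inter
      ((isClosed_eq (by fun_prop) continuous_const).inter
        (isClosed_eq (by fun_prop) continuous_const))
  · rintro P ⟨h1, h2, -⟩
    simpa using norm_prod_le_iff.2 ⟨norm_le_one_of_unit h1, norm_le_one_of_unit h2⟩

theorem orthonormalPairs_nonempty : orthonormalPairs.Nonempty :=
  ⟨(Pi.single 0 1, Pi.single 1 1), by simp [orthonormalPairs, Fin.sum_univ_four]⟩

theorem continuous_pairForm :
    Continuous fun P : Matrix (Fin 4) (Fin 4) ℝ × ((Fin 4 → ℝ) × (Fin 4 → ℝ)) =>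
      form P.1 P.2.1 P.2.1 + form P.1 P.2.2 P.2.2 := by
  unfold form
  fun_prop

theorem continuous_pairForm_right (A : Matrix (Fin 4) (Fin 4) ℝ) :
    Continuous fun P : (Fin 4 → ℝ) × (Fin 4 → ℝ) => form A P.1 P.1 + form A P.2 P.2 :=
  continuous_pairForm.comp (by fun_prop : Continuous fun P : (Fin 4 → ℝ) × (Fin 4 → ℝ) => (A, P))

/-- The sum of the two lowest eigenvalues of a symmetric matrix. -/
noncomputable def lowestTwo (A : Matrix (Fin 4) (Fin 4) ℝ) : ℝ :=
  sInf ((fun P : (Fin 4 → ℝ) × (Fin 4 → ℝ) => form A P.1 P.1 + form A P.2 P.2) '' orthonormalPairs)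

theorem continuous_lowestTwo : Continuous lowestTwo :=
  isCompact_orthonormalPairs.continuous_sInf continuous_pairForm

theorem exists_pairForm_eq_lowestTwo (A : Matrix (Fin 4) (Fin 4) ℝ) :
    ∃ a b : Fin 4 → ℝ, ∑ i, a i ^ 2 = 1 ∧ ∑ i, b i ^ 2 = 1 ∧ ∑ i, a i * b i = 0 ∧
      form A a a + form A b b = lowestTwo A := by
  obtain ⟨⟨a, b⟩, ⟨h1, h2, h3⟩, h⟩ := exists_eq_sInf isCompact_orthonormalPairs
    orthonormalPairs_nonempty continuous_pairForm_right A
  exact ⟨a, b, h1, h2, h3, h⟩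

theorem lowestTwo_le (A : Matrix (Fin 4) (Fin 4) ℝ) {a b : Fin 4 → ℝ} (ha : ∑ i, a i ^ 2 = 1)
    (hb : ∑ i, b i ^ 2 = 1) (hab : ∑ i, a i * b i = 0) :
    lowestTwo A ≤ form A a a + form A b b :=
  sInf_le_of_mem isCompact_orthonormalPairs continuous_pairForm_right A
    (show (a, b) ∈ orthonormalPairs from ⟨ha, hb, hab⟩)

variable {A : Matrix (Fin 4) (Fin 4) ℝ}

theorem lowestTwo_nonneg (hA : A.PosSemidef) : 0 ≤ lowestTwo A := by
  obtain ⟨a, b, -, -, -, h⟩ := exists_pairForm_eq_lowestTwo A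
  rw [← h]
  exact add_nonneg (form_nonneg hA a) (form_nonneg hA b)

theorem isSymm_of_posSemidef (hA : A.PosSemidef) : A.IsSymm := by
  simpa [Matrix.IsHermitian, Matrix.IsSymm] using hA.1

/-- Almost orthonormal pairs. -/
theorem lowestTwo_le_of_almost (hA : A.PosSemidef) {a b : Fin 4 → ℝ} (ha : 1 ≤ ∑ i, a i ^ 2)
    (hb : 1 + (∑ i, a i * b i) ^ 2 ≤ ∑ i, b i ^ 2) (hab : |∑ i, a i * b i| ≤ 1) :
    lowestTwo A ≤ (1 + 2 * |∑ i, a i * b i|) * (form A a a + form A b b) := by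
  have hsymm := isSymm_of_posSemidef hA
  obtain ⟨s, a₁, rfl, ha₁⟩ := exists_smul_unit a
  simp only [Pi.smul_apply, smul_eq_mul, mul_pow, ← Finset.mul_sum, ha₁, mul_assoc] at ha hb hab ⊢
  rw [mul_one] at ha
  set κ := ∑ i, a₁ i * b i with hκ
  have hκs : |κ| ≤ |s * κ| := by
    rw [abs_mul]
    exact le_mul_of_one_le_left (abs_nonneg _) ((one_le_sq_iff_one_le_abs s).1 ha)
  -- Gram-Schmidt. The norm hypotheses give `1 ≤ s ^ 2` and `1 ≤ s' ^ 2`, so normalising does not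
  -- increase the form; the projection costs at most `2 * |κ|` times the sum of the two forms.
  obtain ⟨s', b₁, hb₁, hb₁u⟩ := exists_smul_unit (b + (-κ) • a₁)
  have hsq : s' ^ 2 = ∑ i, b i ^ 2 - κ ^ 2 := by
    have e1 : ∑ i, (b + (-κ) • a₁) i ^ 2 = s' ^ 2 := by
      rw [hb₁]
      simp only [Pi.smul_apply, smul_eq_mul, mul_pow, ← Finset.mul_sum, hb₁u, mul_one]
    have e2 : ∑ i, (b + (-κ) • a₁) i ^ 2
        = ∑ i, b i ^ 2 - 2 * κ * ∑ i, a₁ i * b i + κ ^ 2 * ∑ i, a₁ i ^ 2 := by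
      simp only [Fin.sum_univ_four, Pi.add_apply, Pi.smul_apply, smul_eq_mul]
      ring
    rw [ha₁, ← hκ] at e2
    linarith
  have hκ2 : κ ^ 2 ≤ (s * κ) ^ 2 := sq_le_sq.2 hκs
  have hs' : 1 ≤ s' ^ 2 := by linarith
  have hs'0 : s' ≠ 0 := by rintro rfl; norm_num at hs'
  have horth : ∑ i, a₁ i * b₁ i = 0 := by
    have e : s' * ∑ i, a₁ i * b₁ i = ∑ i, a₁ i * (b + (-κ) • a₁) i := by
      rw [hb₁]
      simp only [Pi.smul_apply, smul_eq_mul, Finset.mul_sum]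
      exact Finset.sum_congr rfl fun i _ => by ring
    have e2 : ∑ i, a₁ i * (b + (-κ) • a₁) i = ∑ i, a₁ i * b i - κ * ∑ i, a₁ i ^ 2 := by
      simp only [Fin.sum_univ_four, Pi.add_apply, Pi.smul_apply, smul_eq_mul]
      ring
    rw [e2, ha₁, ← hκ, mul_one, sub_self] at e
    exact (mul_eq_zero.1 e).resolve_left hs'0
  have h1 := lowestTwo_le A ha₁ hb₁u horth
  have hA1 := form_nonneg hA a₁
  have hB1 := form_nonneg hA b₁
  have hB := form_nonneg hA b
  have h2 : form A b₁ b₁ ≤ form A b b - 2 * κ * form A a₁ b + κ ^ 2 * form A a₁ a₁ := by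
    have e : form A (b + (-κ) • a₁) (b + (-κ) • a₁) = s' ^ 2 * form A b₁ b₁ := by
      rw [hb₁, form_smul_left, form_smul_right]; ring
    simp only [form_add_left, form_add_right, form_smul_left, form_smul_right,
      form_comm hsymm b a₁] at e
    nlinarith
  have hplus := form_nonneg hA (a₁ + b)
  have hminus := form_nonneg hA (a₁ + (-1 : ℝ) • b)
  simp only [form_add_left, form_add_right, form_smul_left, form_smul_right,
      form_comm hsymm b a₁] at hplus hminus
  have h3 : |2 * form A a₁ b| ≤ form A a₁ a₁ + form A b b :=
    abs_le.2 ⟨by linarith, by linarith⟩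
  have h4 : -(2 * κ * form A a₁ b) ≤ |κ| * (form A a₁ a₁ + form A b b) := by
    calc -(2 * κ * form A a₁ b) ≤ |2 * κ * form A a₁ b| := neg_le_abs _
      _ = |κ| * |2 * form A a₁ b| := by rw [← abs_mul]; ring_nf
      _ ≤ _ := by gcongr
  have hκ1 : |κ| ≤ 1 := hκs.trans hab
  have h5 : κ ^ 2 ≤ |κ| := by
    rw [← sq_abs]
    nlinarith [abs_nonneg κ]
  have h6 : form A a₁ a₁ ≤ form A (s • a₁) (s • a₁) := by
    rw [form_smul_left, form_smul_right]
    nlinarith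
  have h7 : κ ^ 2 * form A a₁ a₁ ≤ |κ| * (form A a₁ a₁ + form A b b) := by
    have := mul_le_mul_of_nonneg_right h5 hA1
    nlinarith [mul_nonneg (abs_nonneg κ) hB]
  calc lowestTwo A ≤ (1 + 2 * |κ|) * (form A a₁ a₁ + form A b b) := by linarith
    _ ≤ (1 + 2 * |s * κ|) * (form A (s • a₁) (s • a₁) + form A b b) := by gcongr

/-- If the lowest eigenvalue vanishes, the sum of the two lowest is attained at a null vector and
an eigenvector orthogonal to it. -/
theorem exists_null_eigen (hA : A.PosSemidef) (h0 : lowest A = 0) :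
    ∃ e f : Fin 4 → ℝ, ∑ i, e i ^ 2 = 1 ∧ ∑ i, f i ^ 2 = 1 ∧ ∑ i, e i * f i = 0 ∧
      (∀ i, ∑ j, A i j * e j = 0) ∧ ∀ i, ∑ j, A i j * f j = lowestTwo A * f i := by
  have hsymm := isSymm_of_posSemidef hA
  obtain ⟨e, heu, he⟩ := exists_form_eq_lowest A
  have heig : ∀ i, ∑ j, A i j * e j = 0 := by
    have := eigen_of_isMin hsymm (lam := lowest A) (by rw [he, heu, mul_one]) (lowest_mul_le A)
    simpa [h0] using this
  have hnull : ∀ g, form A e g = 0 := fun g => by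
    rw [form_eigen hsymm (lam := 0) (by simpa using heig), zero_mul]
  obtain ⟨a, b, hau, hbu, hab, hmin⟩ := exists_pairForm_eq_lowestTwo A
  -- Rotating the minimising pair in its plane preserves the sum of the forms; some unit combination
  -- `f` is orthogonal to the null vector `e`, and positivity of the other one gives `form A f f ≤
  -- lowestTwo A`.
  obtain ⟨α, β, hαβ, hperp⟩ : ∃ α β : ℝ, α ^ 2 + β ^ 2 = 1 ∧
      α * ∑ i, e i * a i + β * ∑ i, e i * b i = 0 := by
    set m := ∑ i, e i * a i
    set n := ∑ i, e i * b i
    by_cases h : m ^ 2 + n ^ 2 = 0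
    · have hm : m = 0 := by nlinarith [sq_nonneg m, sq_nonneg n]
      have hn : n = 0 := by nlinarith [sq_nonneg m, sq_nonneg n]
      exact ⟨1, 0, by norm_num, by rw [hm, hn]; ring⟩
    · have hpos : 0 < m ^ 2 + n ^ 2 := lt_of_le_of_ne (by positivity) (Ne.symm h)
      have hs := Real.sq_sqrt hpos.le
      have hs0 := (Real.sqrt_pos.2 hpos).ne'
      refine ⟨n / √(m ^ 2 + n ^ 2), -m / √(m ^ 2 + n ^ 2), ?_, ?_⟩
      · rw [div_pow, div_pow, hs, ← add_div, div_eq_one_iff_eq h]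
        ring
      · field_simp
        ring
  set f := α • a + β • b with hfdef
  have hfu : ∑ i, f i ^ 2 = 1 := by
    have : ∑ i, f i ^ 2 = α ^ 2 * ∑ i, a i ^ 2 + 2 * α * β * ∑ i, a i * b i
        + β ^ 2 * ∑ i, b i ^ 2 := by
      simp only [hfdef, Fin.sum_univ_four, Pi.add_apply, Pi.smul_apply, smul_eq_mul]
      ring
    rw [this, hau, hbu, hab]
    linarith
  have hef : ∑ i, e i * f i = 0 := by
    rw [← hperp]
    simp only [hfdef, Fin.sum_univ_four, Pi.add_apply, Pi.smul_apply, smul_eq_mul]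
    ring
  have hfle : form A f f ≤ lowestTwo A := by
    have h1 := form_nonneg hA ((-β) • a + α • b)
    rw [← hmin]
    simp only [hfdef, form_add_left, form_add_right, form_smul_left, form_smul_right,
      form_comm hsymm b a] at h1 ⊢
    linear_combination h1 + (form A a a + form A b b) * hαβ
  have hfeq : form A f f = lowestTwo A := by
    refine le_antisymm hfle ?_
    have := lowestTwo_le A heu hfu hef
    rwa [hnull, zero_add] at this
  refine ⟨e, f, heu, hfu, hef, heig, ?_⟩
  set lam := lowestTwo A with hlam
  -- Raising the null direction `e` to eigenvalue `lam` makes `f` an unconstrained minimiser of the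
  -- Rayleigh quotient, so `eigen_of_isMin` applies.
  set A' : Matrix (Fin 4) (Fin 4) ℝ := A + Matrix.of fun i j => lam * (e i * e j) with hA'
  have hform : ∀ g, form A' g g = form A g g + lam * (∑ i, e i * g i) ^ 2 := by
    intro g
    simp only [hA', form, Matrix.add_apply, Matrix.of_apply, Fin.sum_univ_four]
    ring
  have hsymm' : A'.IsSymm := by
    ext i j
    simp [hA', hsymm.apply i j, mul_comm (e i)]
  have := eigen_of_isMin (A := A') (f := f) (lam := lam) hsymm'
    (by rw [hform, hfeq, hef, hfu]; ring) (fun g => by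
      rw [hform]
      set s := ∑ i, e i * g i with hs
      obtain ⟨c, g₁, hg₁, hg₁u⟩ := exists_smul_unit (g + (-s) • e)
      have hsq : ∑ i, g i ^ 2 = s ^ 2 + c ^ 2 := by
        have e1 : ∑ i, (g + (-s) • e) i ^ 2 = c ^ 2 := by
          rw [hg₁]
          simp only [Pi.smul_apply, smul_eq_mul, mul_pow, ← Finset.mul_sum, hg₁u, mul_one]
        have e2 : ∑ i, (g + (-s) • e) i ^ 2
            = ∑ i, g i ^ 2 - 2 * s * ∑ i, e i * g i + s ^ 2 * ∑ i, e i ^ 2 := by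
          simp only [Fin.sum_univ_four, Pi.add_apply, Pi.smul_apply, smul_eq_mul]
          ring
        rw [heu, ← hs] at e2
        linarith
      have hgg : form A g g = c ^ 2 * form A g₁ g₁ := by
        have h1 : form A (g + (-s) • e) (g + (-s) • e) = c ^ 2 * form A g₁ g₁ := by
          rw [hg₁, form_smul_left, form_smul_right]; ring
        rw [← h1]
        simp only [form_add_left, form_add_right, form_smul_left, form_smul_right,
          form_comm hsymm g e, hnull]
        ring
      by_cases hc : c = 0
      · rw [hsq, hgg, hc]
        nlinarith
      · have horth : ∑ i, e i * g₁ i = 0 := by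
          have h1 : c * ∑ i, e i * g₁ i = ∑ i, e i * (g + (-s) • e) i := by
            rw [hg₁]
            simp only [Pi.smul_apply, smul_eq_mul, Finset.mul_sum]
            exact Finset.sum_congr rfl fun i _ => by ring
          have h2 : ∑ i, e i * (g + (-s) • e) i = ∑ i, e i * g i - s * ∑ i, e i ^ 2 := by
            simp only [Fin.sum_univ_four, Pi.add_apply, Pi.smul_apply, smul_eq_mul]
            ring
          rw [h2, heu, ← hs, mul_one, sub_self] at h1
          exact (mul_eq_zero.1 h1).resolve_left hc
        have h2 := lowestTwo_le A heu hg₁u horth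
        rw [hnull, zero_add, ← hlam] at h2
        rw [hsq, hgg]
        nlinarith [sq_nonneg c])
  intro i
  rw [← this i]
  have h1 : ∑ j, A' i j * f j = ∑ j, A i j * f j + lam * e i * ∑ j, e j * f j := by
    simp only [hA', Matrix.add_apply, Matrix.of_apply, add_mul, Finset.sum_add_distrib,
      Finset.mul_sum]
    congr 1
    exact Finset.sum_congr rfl fun j _ => by ring
  rw [h1, hef, mul_zero, add_zero]

end ConstRank

/-! ### Touching tests for two fields and propagation of the second zero -/

namespace ConstRank

section Solution

variable {Ω : Set E4} {v : E4 → ℝ} {x : E4}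

/-- First and second order conditions when a quadratic touches the sum of the two lowest
eigenvalues from below along a line, tested with the fields `e + t τ` and `f + t σ`. -/
theorem two_field_test (hΩ : IsOpen Ω) (hv : ContDiffOn ℝ 4 v Ω)
    (hpsd : ∀ y ∈ Ω, (hess v y).PosSemidef) (hx : x ∈ Ω) {d e f τ σ : Fin 4 → ℝ} {lam β γ : ℝ}
    (heu : ∑ i, e i ^ 2 = 1) (hfu : ∑ i, f i ^ 2 = 1) (hef : ∑ i, e i * f i = 0)
    (he : ∀ i, ∑ j, hess v x i j * e j = 0) (hf : ∀ i, ∑ j, hess v x i j * f j = lam * f i)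
    (h : ∀ᶠ t in 𝓝 (0 : ℝ), lam + t * β + t * t * (γ / 2) ≤ lowestTwo (hess v (x + t • vec d)))
    (heτ : ∑ i, e i * τ i = 0) (hfσ : ∑ i, f i * σ i = 0)
    (hcross : ∑ i, e i * σ i + ∑ i, f i * τ i = 0) :
    form (hess₁ v x d) e e + form (hess₁ v x d) f f = β ∧
    γ ≤ (form (hess₂ v x d) e e + 4 * form (hess₁ v x d) e τ + 2 * form (hess v x) τ τ)
      + (form (hess₂ v x d) f f + 4 * form (hess₁ v x d) f σ + 2 * form (hess v x) σ σ)
      + 4 * |∑ i, τ i * σ i| * lam := by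
  have hsymm := isSymm_hess hpsd hx
  have he0 : ∀ a, form (hess v x) e a = 0 := fun a => by
    rw [form_eigen hsymm (lam := 0) (by simpa using he), zero_mul]
  have hff : form (hess v x) f f = lam := by
    rw [form_eigen hsymm hf]
    simp only [← sq, hfu, mul_one]
  have hfσ' : form (hess v x) f σ = 0 := by rw [form_eigen hsymm hf, hfσ, mul_zero]
  set k := ∑ i, τ i * σ i with hk
  -- The moving pair has inner product `t ^ 2 * k`; the factor `1 + 2 * t ^ 2 * |k|` is the loss
  -- allowed by `lowestTwo_le_of_almost`.
  have hj := (((hasJet_quadratic 1 0 (4 * |k|)).mul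
    ((hasJet_form hΩ hv hpsd hx d e τ).add (hasJet_form hΩ hv hpsd hx d f σ))).sub
    (hasJet_quadratic lam β γ))
  rw [he0, he0, hff, hfσ'] at hj
  obtain ⟨h1, h2⟩ := (hj.congr (by ring) rfl rfl).of_nonneg (by
    have hc : Continuous fun t : ℝ => t ^ 2 * ∑ i, τ i ^ 2 := by fun_prop
    have hc' : Continuous fun t : ℝ => |t ^ 2 * k| := by fun_prop
    have hsm : ∀ᶠ t in 𝓝 (0 : ℝ), t ^ 2 * ∑ i, τ i ^ 2 < 1 :=
      hc.continuousAt.eventually (gt_mem_nhds (by norm_num))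
    have hsm' : ∀ᶠ t in 𝓝 (0 : ℝ), |t ^ 2 * k| < 1 :=
      hc'.continuousAt.eventually (gt_mem_nhds (by norm_num))
    filter_upwards [h, eventually_line hΩ hx d, hsm, hsm'] with t ht htΩ ht1 ht2
    have e1 : ∑ i, (e + t • τ) i ^ 2 = 1 + t ^ 2 * ∑ i, τ i ^ 2 := by
      have : ∑ i, (e + t • τ) i ^ 2
          = ∑ i, e i ^ 2 + 2 * t * ∑ i, e i * τ i + t ^ 2 * ∑ i, τ i ^ 2 := by
        simp only [Fin.sum_univ_four, Pi.add_apply, Pi.smul_apply, smul_eq_mul]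
        ring
      rw [this, heu, heτ]; ring
    have e2 : ∑ i, (f + t • σ) i ^ 2 = 1 + t ^ 2 * ∑ i, σ i ^ 2 := by
      have : ∑ i, (f + t • σ) i ^ 2
          = ∑ i, f i ^ 2 + 2 * t * ∑ i, f i * σ i + t ^ 2 * ∑ i, σ i ^ 2 := by
        simp only [Fin.sum_univ_four, Pi.add_apply, Pi.smul_apply, smul_eq_mul]
        ring
      rw [this, hfu, hfσ]; ring
    have e3 : ∑ i, (e + t • τ) i * (f + t • σ) i = t ^ 2 * k := by
      have : ∑ i, (e + t • τ) i * (f + t • σ) i = ∑ i, e i * f i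
          + t * (∑ i, e i * σ i + ∑ i, f i * τ i) + t ^ 2 * ∑ i, τ i * σ i := by
        simp only [Fin.sum_univ_four, Pi.add_apply, Pi.smul_apply, smul_eq_mul]
        ring
      rw [this, hef, hcross, ← hk]; ring
    have hτ0 : 0 ≤ ∑ i, τ i ^ 2 := Finset.sum_nonneg fun i _ => sq_nonneg _
    have hσ0 : 0 ≤ ∑ i, σ i ^ 2 := Finset.sum_nonneg fun i _ => sq_nonneg _
    have hcs : k ^ 2 ≤ (∑ i, τ i ^ 2) * ∑ i, σ i ^ 2 := Finset.sum_mul_sq_le_sq_mul_sq _ _ _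
    have key := lowestTwo_le_of_almost (hpsd _ htΩ) (a := e + t • τ) (b := f + t • σ)
      (by rw [e1]; nlinarith [sq_nonneg t])
      (by
        rw [e2, e3]
        have h3 : t ^ 2 * k ^ 2 ≤ t ^ 2 * ((∑ i, τ i ^ 2) * ∑ i, σ i ^ 2) := by gcongr
        have h4 : (t ^ 2 * ∑ i, τ i ^ 2) * ∑ i, σ i ^ 2 ≤ 1 * ∑ i, σ i ^ 2 := by gcongr
        have h5 : t ^ 2 * (t ^ 2 * k ^ 2) ≤ t ^ 2 * ∑ i, σ i ^ 2 := by
          gcongr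
          linarith
        nlinarith)
      (by rw [e3]; exact ht2.le)
    rw [e3, abs_mul, abs_of_nonneg (sq_nonneg t)] at key
    have e4 : 1 + t * 0 + t * t * (4 * |k| / 2) = 1 + 2 * (t ^ 2 * |k|) := by ring
    rw [e4]
    linarith)
  exact ⟨by linarith, by linarith⟩

/-- At a point where the Hessian has a null vector `e`, a correction `T` for which the contracted
second variation vanishes describes the derivative of the null vector. -/
theorem hess₁_null (hΩ : IsOpen Ω) (hv : ContDiffOn ℝ 4 v Ω)
    (hpsd : ∀ y ∈ Ω, (hess v y).PosSemidef) (hx : x ∈ Ω) {e : Fin 4 → ℝ} {θ : ℝ} (hθ : 0 < θ)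
    (hell : ∀ ξ : Fin 4 → ℝ, θ * ∑ i, ξ i ^ 2 ≤ ∑ i, ∑ j, coefAt v x i j * (ξ i * ξ j))
    (heu : ∑ i, e i ^ 2 = 1) (he : ∀ i, ∑ j, hess v x i j * e j = 0)
    {T : Matrix (Fin 4) (Fin 4) ℝ}
    (hT : ∑ i, ∑ j, coefAt v x i j * secVar v x e T i j = 0) :
    (∀ d, form (hess₁ v x d) e e = 0) ∧
    ∀ d g, form (hess₁ v x d) e g = -form (hess v x) (rowComb d T) g := by
  have htest : ∀ d τ, form (hess₁ v x d) e e = 0 ∧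
      0 ≤ form (hess₂ v x d) e e + 4 * form (hess₁ v x d) e τ + 2 * form (hess v x) τ τ := by
    intro d τ
    have := one_field_test hΩ hv hpsd hx (d := d) (lam := 0) (β := 0) (γ := 0) heu
      (by simpa using he) (by
        filter_upwards [eventually_line hΩ hx d] with t ht g
        simpa using form_nonneg (hpsd _ ht) g) τ
    simpa using this
  refine ⟨fun d => (htest d 0).1, ?_⟩
  have hN : ∀ d, 0 ≤ form (secVar v x e T) d d := fun d => by
    rw [form_secVar hΩ hv hx]
    exact (htest d _).2
  -- The form of `secVar` is nonnegative while its contraction with the coefficients is zero. The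
  -- coefficients minus `θ • 1` are still positive semidefinite, so `θ` times its trace is at most 0
  -- and its diagonal vanishes.
  have hdiag : ∀ i, form (secVar v x e T) (Pi.single i 1) (Pi.single i 1) = 0 := by
    have hsub : ∀ N : Matrix (Fin 4) (Fin 4) ℝ, ∑ i, ∑ j, (coefAt v x - θ • 1) i j * N i j
        = ∑ i, ∑ j, coefAt v x i j * N i j - θ * ∑ i, N i i := by
      intro N
      simp [sub_mul, Finset.sum_sub_distrib, Matrix.one_apply, Finset.mul_sum]
    obtain ⟨B, hB⟩ := exists_contraction (a := coefAt v x - θ • 1)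
      ((isSymm_coefAt v x).sub (Matrix.isSymm_one.smul θ)) (fun ξ => by
        have := hsub (Matrix.of fun i j => ξ i * ξ j)
        simp only [Matrix.of_apply, ← sq] at this
        rw [this]
        linarith [hell ξ])
    have h1 := hB (secVar v x e T)
    rw [hsub, hT] at h1
    have h2 : 0 ≤ ∑ k, form (secVar v x e T) (B k) (B k) := Finset.sum_nonneg fun k _ => hN _
    have hii : ∀ i, form (secVar v x e T) (Pi.single i 1) (Pi.single i 1) = secVar v x e T i i := by
      intro i
      simp [form, Pi.single_apply]
    have h3 : ∀ i, 0 ≤ secVar v x e T i i := fun i => hii i ▸ hN _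
    have h4 : ∑ i, secVar v x e T i i ≤ 0 := by
      by_contra! hpos
      nlinarith
    intro i
    rw [hii]
    exact (Finset.sum_eq_zero_iff_of_nonneg fun i _ => h3 i).1
      (le_antisymm h4 (Finset.sum_nonneg fun i _ => h3 i)) i (Finset.mem_univ i)
  -- Along a basis direction `T i` therefore minimises the nonnegative second-order expression in
  -- the field; its first-order condition is the claim, and linearity extends it to all directions.
  have hbasis : ∀ i g, form (hess₁ v x (Pi.single i 1)) e g = -form (hess v x) (T i) g := by
    intro i g
    have hrow : rowComb (Pi.single i 1) T = T i := by
      funext k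
      simp [rowComb, Pi.single_apply]
    have h0 := hdiag i
    rw [form_secVar hΩ hv hx, hrow] at h0
    have hsymm := isSymm_hess hpsd hx
    have := eq_zero_of_quadratic_nonneg
      (b := 4 * (form (hess₁ v x (Pi.single i 1)) e g + form (hess v x) (T i) g))
      (c := 2 * form (hess v x) g g) (fun t => by
        have ht := (htest (Pi.single i 1) (T i + t • g)).2
        simp only [form_add_left, form_add_right, form_smul_left, form_smul_right,
          form_comm hsymm g (T i)] at ht
        nlinarith)
    linarith
  intro d g
  have e1 : form (hess₁ v x d) e g = ∑ i, d i * form (hess₁ v x (Pi.single i 1)) e g := by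
    simp only [form, hess₁, Matrix.of_apply, Fin.sum_univ_four]
    simp
    ring
  have e2 : form (hess v x) (rowComb d T) g = ∑ i, d i * form (hess v x) (T i) g := by
    simp only [form, rowComb, Fin.sum_univ_four]
    ring
  rw [e1, e2, ← Finset.sum_neg_distrib]
  exact Finset.sum_congr rfl fun i _ => by rw [hbasis]; ring

/-- If the lowest eigenvalue of the Hessian vanishes identically near a point where the two lowest
eigenvalues vanish, then both vanish nearby. -/
theorem lowestTwo_eq_zero (hΩ : IsOpen Ω) (hv : ContDiffOn ℝ 4 v Ω)
    (hpsd : ∀ y ∈ Ω, (hess v y).PosSemidef) {x₀ : E4} {r θ C : ℝ} (hr : 0 < r) (hθ : 0 < θ)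
    (hC : 0 < C) (hsub : Metric.ball x₀ r ⊆ Ω) (hb : LocalBounds v x₀ r θ C)
    (hlow : ∀ y ∈ Metric.ball x₀ r, lowest (hess v y) = 0)
    (h0 : lowestTwo (hess v x₀) = 0) :
    ∀ y ∈ Metric.ball x₀ (r / 4), lowestTwo (hess v y) = 0 := by
  have hCC : C ≤ C + 64 * C ^ 2 + 3840 * C ^ 3 := by
    have : 0 ≤ 64 * C ^ 2 + 3840 * C ^ 3 := by positivity
    linarith
  refine strong_minimum_principle (w := fun y => lowestTwo (hess v y)) (a := coefAt v) (θ := θ)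
    (C := C + 64 * C ^ 2 + 3840 * C ^ 3) hr hθ (by positivity) ?_
    (fun y hy => lowestTwo_nonneg (hpsd y (hsub hy)))
    h0 hb.elliptic (fun x hx => (hb.trace x hx).trans hCC) ?_
  · refine continuous_lowestTwo.comp_continuousOn ?_
    exact continuousOn_pi.2 fun i => continuousOn_pi.2 fun j =>
      ((contDiffOn_hess hΩ hv i j).continuousOn).mono hsub
  · intro x hx b Q hQ
    have hxΩ := hsub hx
    have hsymm := isSymm_hess hpsd hxΩ
    obtain ⟨e, f, heu, hfu, hef, he, hf⟩ := exists_null_eigen (hpsd x hxΩ) (hlow x hx)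
    set lam := lowestTwo (hess v x) with hlam
    have hlam0 : 0 ≤ lam := lowestTwo_nonneg (hpsd x hxΩ)
    obtain ⟨Te, hTe, hNe⟩ := hb.correction x hx e 0 heu (by simpa using he)
    obtain ⟨Tf, hTf, hNf⟩ := hb.correction x hx f lam hfu hf
    have hgrade : grad₃ v x e = 0 := grad₃_eq_of_form hΩ hv hxΩ fun d => by
      have := (one_field_test hΩ hv hpsd hxΩ (d := d) (lam := 0) (β := 0) (γ := 0) heu
        (by simpa using he) (by
          filter_upwards [eventually_line hΩ hxΩ d] with t ht g
          simpa using form_nonneg (hpsd _ ht) g) 0).1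
      simpa using this
    -- The eigenvalue 0 persists with zero slope, so the error allowed for `e` is exactly 0 and
    -- `hess₁_null` applies.
    have hNe0 : ∑ i, ∑ j, coefAt v x i j * secVar v x e Te i j = 0 := by
      simpa [hgrade] using hNe
    obtain ⟨hXee, hXeg⟩ := hess₁_null hΩ hv hpsd hxΩ hθ (hb.elliptic x hx) heu he hNe0
    have he0 : ∀ a, form (hess v x) e a = 0 := fun a => by
      rw [form_eigen hsymm (lam := 0) (by simpa using he), zero_mul]
    have hff : form (hess v x) f f = lam := by
      rw [form_eigen hsymm hf]
      simp only [← sq, hfu, mul_one]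
    have htest : ∀ d, form (hess₁ v x d) f f = ∑ i, b i * d i ∧
        form Q d d ≤ form (secVar v x e Te) d d + form (secVar v x f Tf) d d
          + (3840 * C ^ 2 * lam + 64 * C * ∑ i, |b i|) * ‖d‖ ^ 2 := by
      intro d
      set τ₀ := rowComb d Te with hτ₀
      set σ₀ := rowComb d Tf with hσ₀
      set m₁ := ∑ i, e i * τ₀ i with hm₁
      set m₂ := ∑ i, f i * τ₀ i with hm₂
      set n₁ := ∑ i, e i * σ₀ i with hn₁
      set n₂ := ∑ i, f i * σ₀ i with hn₂
      set β := ∑ i, b i * d i with hβ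
      have dot : ∀ a g : Fin 4 → ℝ, ∀ s t : ℝ, ∑ i, a i * (g + (-s) • e + (-t) • f) i
          = ∑ i, a i * g i - s * ∑ i, e i * a i - t * ∑ i, f i * a i := by
        intro a g s t
        simp only [Fin.sum_univ_four, Pi.add_apply, Pi.smul_apply, smul_eq_mul]
        ring
      have hfe : ∑ i, f i * e i = 0 := by
        rw [← hef]
        exact Finset.sum_congr rfl fun i _ => mul_comm _ _
      have hee : ∑ i, e i * e i = 1 := by simpa only [sq] using heu
      have hff' : ∑ i, f i * f i = 1 := by simpa only [sq] using hfu
      -- The corrections are projected off the span of `e` and `f` to meet the orthogonality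
      -- conditions.
      obtain ⟨h1, h2⟩ := two_field_test hΩ hv hpsd hxΩ (d := d) (γ := form Q d d)
        (τ := τ₀ + (-m₁) • e + (-m₂) • f) (σ := σ₀ + (-n₁) • e + (-n₂) • f) heu hfu hef he hf
        (eventually_line_le (w := fun y => lowestTwo (hess v y)) hQ d)
        (by rw [dot e, hee, hfe]; ring) (by rw [dot f, hef, hff']; ring)
        (by rw [dot e, dot f, hee, hfe, hef, hff']; ring)
      rw [hXee, zero_add, ← hβ] at h1
      have hXs := isSymm_hess₁ hΩ hv hxΩ d
      -- The decisive cross term: without `hess₁_null` it would not be controlled by `lam`. It makes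
      -- every cost of the projection a multiple of `lam` or of the slope `β`.
      have hXef : form (hess₁ v x d) e f = -(lam * m₂) := by
        rw [hXeg, form_comm hsymm, form_eigen hsymm hf]
      have hfτ : form (hess v x) f τ₀ = lam * m₂ := form_eigen hsymm hf _
      have hfσ : form (hess v x) f σ₀ = lam * n₂ := form_eigen hsymm hf _
      have hdot : ∑ i, (τ₀ + (-m₁) • e + (-m₂) • f) i * (σ₀ + (-n₁) • e + (-n₂) • f) i
          = ∑ i, τ₀ i * σ₀ i - m₁ * n₁ - m₂ * n₂ := by
        have : ∑ i, (τ₀ + (-m₁) • e + (-m₂) • f) i * (σ₀ + (-n₁) • e + (-n₂) • f) i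
            = ∑ i, τ₀ i * σ₀ i - n₁ * (∑ i, e i * τ₀ i) - n₂ * (∑ i, f i * τ₀ i)
              - m₁ * (∑ i, e i * σ₀ i) - m₂ * (∑ i, f i * σ₀ i) + m₁ * n₁ * (∑ i, e i * e i)
              + (m₁ * n₂ + m₂ * n₁) * (∑ i, e i * f i) + m₂ * n₂ * (∑ i, f i * f i) := by
          simp only [Fin.sum_univ_four, Pi.add_apply, Pi.smul_apply, smul_eq_mul]
          ring
        rw [this, hee, hef, hff', ← hm₁, ← hm₂, ← hn₁, ← hn₂]
        ring
      rw [hdot] at h2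
      simp only [form_add_left, form_add_right, form_smul_left, form_smul_right,
        form_comm hsymm τ₀ e, form_comm hsymm τ₀ f, form_comm hsymm σ₀ e, form_comm hsymm σ₀ f,
        form_comm hsymm f e, he0, hff, hfτ, hfσ, form_comm hXs f e, hXee, hXef, h1] at h2
      have hnτ : ‖τ₀‖ ≤ 4 * C * ‖d‖ := norm_rowComb_le hTe d
      have hnσ : ‖σ₀‖ ≤ 4 * C * ‖d‖ := norm_rowComb_le hTf d
      have hunitdot : ∀ a g : Fin 4 → ℝ, ∑ i, a i ^ 2 = 1 → ‖g‖ ≤ 4 * C * ‖d‖ →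
          |∑ i, a i * g i| ≤ 16 * C * ‖d‖ := by
        intro a g ha hg
        refine abs_dot_le_norm.trans ?_
        calc 4 * ‖a‖ * ‖g‖ ≤ 4 * 1 * (4 * C * ‖d‖) := by
              gcongr
              exact norm_le_one_of_unit ha
          _ = _ := by ring
      have bm₁ : |m₁| ≤ 16 * C * ‖d‖ := hunitdot e τ₀ heu hnτ
      have bm₂ : |m₂| ≤ 16 * C * ‖d‖ := hunitdot f τ₀ hfu hnτ
      have bn₁ : |n₁| ≤ 16 * C * ‖d‖ := hunitdot e σ₀ heu hnσ
      have bn₂ : |n₂| ≤ 16 * C * ‖d‖ := hunitdot f σ₀ hfu hnσ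
      have bβ : |β| ≤ (∑ i, |b i|) * ‖d‖ := abs_dot_le
      have hprod : ∀ s t : ℝ, |s| ≤ 16 * C * ‖d‖ → |t| ≤ 16 * C * ‖d‖ →
          |s * t| ≤ 256 * C ^ 2 * ‖d‖ ^ 2 := by
        intro s t hs ht
        rw [abs_mul]
        calc |s| * |t| ≤ (16 * C * ‖d‖) * (16 * C * ‖d‖) := by gcongr
          _ = _ := by ring
      have bτσ : |∑ i, τ₀ i * σ₀ i| ≤ 64 * C ^ 2 * ‖d‖ ^ 2 := by
        refine abs_dot_le_norm.trans ?_
        calc 4 * ‖τ₀‖ * ‖σ₀‖ ≤ 4 * (4 * C * ‖d‖) * (4 * C * ‖d‖) := by gcongr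
          _ = _ := by ring
      have bk : |∑ i, τ₀ i * σ₀ i - m₁ * n₁ - m₂ * n₂| ≤ 576 * C ^ 2 * ‖d‖ ^ 2 := by
        refine (abs_sub _ _).trans ?_
        have h3 := abs_sub (∑ i, τ₀ i * σ₀ i) (m₁ * n₁)
        have h4 := hprod m₁ n₁ bm₁ bn₁
        have h5 := hprod m₂ n₂ bm₂ bn₂
        linarith
      have h3 : lam * |∑ i, τ₀ i * σ₀ i - m₁ * n₁ - m₂ * n₂| ≤ lam * (576 * C ^ 2 * ‖d‖ ^ 2) := by
        gcongr
      have h4 : lam * (m₂ * m₂) ≤ lam * (256 * C ^ 2 * ‖d‖ ^ 2) :=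
        mul_le_mul_of_nonneg_left ((le_abs_self _).trans (hprod _ _ bm₂ bm₂)) hlam0
      have h5 : lam * (n₁ * m₂) ≤ lam * (256 * C ^ 2 * ‖d‖ ^ 2) :=
        mul_le_mul_of_nonneg_left ((le_abs_self _).trans (hprod _ _ bn₁ bm₂)) hlam0
      have h6 : -(β * n₂) ≤ ((∑ i, |b i|) * ‖d‖) * (16 * C * ‖d‖) := by
        refine (neg_le_abs _).trans ?_
        rw [abs_mul]
        gcongr
      have h7 : 0 ≤ lam * (n₂ * n₂) := mul_nonneg hlam0 (mul_self_nonneg _)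
      refine ⟨h1, ?_⟩
      rw [form_secVar hΩ hv hxΩ, form_secVar hΩ hv hxΩ, ← hτ₀, ← hσ₀]
      -- The constants add up as 2·256 + 4·256 + 4·576 = 3840 for `lam` and 4·16 = 64 for the slope.
      linear_combination h2 + 2 * h4 + 4 * h5 + 4 * h3 + 4 * h6 + 2 * h7
    have hgrad := grad₃_eq_of_form hΩ hv hxΩ fun d => (htest d).1
    have hS : 0 ≤ ∑ i, |b i| := Finset.sum_nonneg fun _ _ => abs_nonneg _
    set K := 3840 * C ^ 2 * lam + 64 * C * ∑ i, |b i| with hK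
    have hK0 : 0 ≤ K := by positivity
    have hdir : ∀ d, form (Q - secVar v x e Te - secVar v x f Tf) d d ≤ K * ∑ i, d i ^ 2 := by
      intro d
      have h1 := (htest d).2
      have h2 : K * ‖d‖ ^ 2 ≤ K * ∑ i, d i ^ 2 := by
        gcongr
        exact sq_norm_le_sum
      have h3 : form (Q - secVar v x e Te - secVar v x f Tf) d d
          = form Q d d - form (secVar v x e Te) d d - form (secVar v x f Tf) d d := by
        simp only [form, Matrix.sub_apply, sub_mul, Finset.sum_sub_distrib]
      rw [h3]
      linarith
    have hcon := contraction_le (isSymm_coefAt v x) (form_nonneg_of_elliptic hθ hb hx) hdir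
    have hsplit : ∑ i, ∑ j, coefAt v x i j * (Q - secVar v x e Te - secVar v x f Tf) i j
        = ∑ i, ∑ j, coefAt v x i j * Q i j - ∑ i, ∑ j, coefAt v x i j * secVar v x e Te i j
          - ∑ i, ∑ j, coefAt v x i j * secVar v x f Tf i j := by
      simp only [Matrix.sub_apply, mul_sub, Finset.sum_sub_distrib]
    rw [hsplit, hNe0] at hcon
    have htr : K * ∑ i, coefAt v x i i ≤ K * C := by
      gcongr
      exact hb.trace x hx
    have hN' := (abs_le.1 hNf).2
    rw [hgrad, abs_of_nonneg hlam0] at hN'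
    change _ ≤ _ * (lam + _)
    have h1 : 0 ≤ C ^ 2 * lam := by positivity
    have h2 : 0 ≤ C ^ 3 * ∑ i, |b i| := by positivity
    rw [hK] at htr hcon
    nlinarith

end Solution

end ConstRank

/-! ### Rank, elementary symmetric functions and the conclusion -/

namespace ConstRank

section Rank

variable {A : Matrix (Fin 4) (Fin 4) ℝ}

theorem exists_null_pair (hA : A.PosSemidef) (hr : A.rank ≤ 2) :
    ∃ a b : Fin 4 → ℝ, ∑ i, a i ^ 2 = 1 ∧ ∑ i, b i ^ 2 = 1 ∧ ∑ i, a i * b i = 0 ∧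
      form A a a = 0 ∧ form A b b = 0 := by
  have hH := hA.1
  have hcard : 1 < Fintype.card {i // hH.eigenvalues i = 0} := by
    rw [hH.rank_eq_card_non_zero_eigs] at hr
    have := Fintype.card_subtype_compl fun i => hH.eigenvalues i = 0
    simp only [Fintype.card_fin] at this
    have h2 : Fintype.card {i // ¬hH.eigenvalues i = 0} ≤ 2 := hr
    omega
  obtain ⟨⟨i, hi⟩, ⟨j, hj⟩, hij⟩ := Fintype.one_lt_card_iff.1 hcard
  have hne : i ≠ j := fun h => hij (Subtype.ext h)
  have hon := hH.eigenvectorBasis.orthonormal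
  have hunit : ∀ k, ∑ l, (hH.eigenvectorBasis k) l ^ 2 = 1 := fun k => by
    rw [← norm_sq_eq_sum, hon.1 k, one_pow]
  have hnull : ∀ k, hH.eigenvalues k = 0 →
      form A (hH.eigenvectorBasis k) (hH.eigenvectorBasis k) = 0 := by
    intro k hk
    have h1 : ∀ i, ∑ j, A i j * (hH.eigenvectorBasis k) j = 0 := fun i => by
      have := congrFun (hH.mulVec_eigenvectorBasis k) i
      simpa [hk, Matrix.mulVec, dotProduct] using this
    rw [form_eigen (isSymm_of_posSemidef hA) (lam := 0) (by simpa using h1), zero_mul]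
  refine ⟨hH.eigenvectorBasis i, hH.eigenvectorBasis j, hunit i, hunit j, ?_, hnull i hi,
    hnull j hj⟩
  rw [← inner_eq_sum]
  exact hon.2 hne

theorem lowestTwo_eq_zero_of_rank (hA : A.PosSemidef) (hr : A.rank ≤ 2) : lowestTwo A = 0 := by
  obtain ⟨a, b, ha, hb, hab, hfa, hfb⟩ := exists_null_pair hA hr
  have := lowestTwo_le A ha hb hab
  rw [hfa, hfb, add_zero] at this
  exact le_antisymm this (lowestTwo_nonneg hA)

theorem lowest_eq_zero_of_rank (hA : A.PosSemidef) (hr : A.rank ≤ 2) : lowest A = 0 := by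
  obtain ⟨a, -, ha, -, -, hfa, -⟩ := exists_null_pair hA hr
  have := lowest_mul_le A a
  rw [hfa, ha, mul_one] at this
  exact le_antisymm this (lowest_nonneg hA)

theorem mulVec_eq_zero_of_form (hA : A.PosSemidef) {a : Fin 4 → ℝ} (h : form A a a = 0) :
    A.mulVec a = 0 := by
  have := eigen_of_isMin (isSymm_of_posSemidef hA) (lam := 0) (f := a) (by rw [h, zero_mul])
    (fun g => by rw [zero_mul]; exact form_nonneg hA g)
  funext i
  simpa [Matrix.mulVec, dotProduct] using this i

theorem rank_le_two (hA : A.PosSemidef) (h : lowestTwo A = 0) : A.rank ≤ 2 := by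
  obtain ⟨a, b, ha, hb, hab, hsum⟩ := exists_pairForm_eq_lowestTwo A
  have hfa := form_nonneg hA a
  have hfb := form_nonneg hA b
  have hka : a ∈ LinearMap.ker A.mulVecLin := mulVec_eq_zero_of_form hA (by linarith)
  have hkb : b ∈ LinearMap.ker A.mulVecLin := mulVec_eq_zero_of_form hA (by linarith)
  have hli : LinearIndependent ℝ ![(⟨a, hka⟩ : LinearMap.ker A.mulVecLin), ⟨b, hkb⟩] := by
    rw [LinearIndependent.pair_iff]
    intro s t hst
    have hst' : s • a + t • b = 0 := congrArg Subtype.val hst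
    have e1 : ∑ i, a i * (s • a + t • b) i = s * ∑ i, a i ^ 2 + t * ∑ i, a i * b i := by
      simp only [Fin.sum_univ_four, Pi.add_apply, Pi.smul_apply, smul_eq_mul]
      ring
    have e2 : ∑ i, b i * (s • a + t • b) i = s * ∑ i, a i * b i + t * ∑ i, b i ^ 2 := by
      simp only [Fin.sum_univ_four, Pi.add_apply, Pi.smul_apply, smul_eq_mul]
      ring
    rw [hst', ha, hab] at e1
    rw [hst', hb, hab] at e2
    simp at e1 e2
    exact ⟨e1.symm, e2.symm⟩
  have h2 := hli.fintype_card_le_finrank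
  have h4 := LinearMap.finrank_range_add_finrank_ker A.mulVecLin
  simp only [Fintype.card_fin, Module.finrank_fintype_fun_eq_card] at h2 h4
  rw [Matrix.rank]
  omega

/-- The elementary symmetric functions of order larger than the rank vanish. -/
theorem sigma_eq_zero (hA : A.IsHermitian) {k : ℕ} (hk : A.rank < k) : sigma k A = 0 := by
  have hroots : A.charpoly.roots = Finset.univ.val.map hA.eigenvalues := by
    simpa using hA.roots_charpoly_eq_eigenvalues
  rw [sigma, hroots, Finset.esymm_map_val]
  refine Finset.sum_eq_zero fun s hs => ?_
  by_contra hne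
  have hne' := Finset.prod_ne_zero_iff.1 hne
  have hcard : s.card = k := (Finset.mem_powersetCard.1 hs).2
  rw [hA.rank_eq_card_non_zero_eigs, Fintype.card_subtype] at hk
  have : s.card ≤ (Finset.univ.filter fun i => hA.eigenvalues i ≠ 0).card :=
    Finset.card_le_card fun i hi => by simpa using hne' i hi
  omega

end Rank

/-- The constant rank theorem: near a point where the Hessian of a convex solution has rank at most
two, the Hessian has rank at most two. -/
theorem exists_ball_rank_le_two {Ω : Set E4} {v : E4 → ℝ} {x₀ : E4} (hΩ : IsOpen Ω)
    (hv : ContDiffOn ℝ 4 v Ω) (hpsd : ∀ y ∈ Ω, (hess v y).PosSemidef)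
    (heq : ∀ y ∈ Ω, opFAt v y = 0) (hx₀ : x₀ ∈ Ω) (hrank : (hess v x₀).rank ≤ 2) :
    ∃ r > 0, Metric.ball x₀ r ⊆ Ω ∧ ∀ y ∈ Metric.ball x₀ r, (hess v y).rank ≤ 2 := by
  obtain ⟨r, θ, C, hr, hθ, hC, hsub, hb⟩ := exists_localBounds hΩ hv hpsd heq hx₀
  have h1 := lowest_eq_zero hΩ hv hpsd hr hθ hC hsub hb
    (lowest_eq_zero_of_rank (hpsd x₀ hx₀) hrank)
  have hle : Metric.ball x₀ (r / 4) ⊆ Metric.ball x₀ r := Metric.ball_subset_ball (by linarith)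
  -- The second propagation needs the lowest eigenvalue to vanish on the whole ball, hence the
  -- restriction to the radius produced by the first.
  have hb' : LocalBounds v x₀ (r / 4) θ C :=
    ⟨fun x hx => hb.elliptic x (hle hx), fun x hx => hb.trace x (hle hx),
      fun x hx => hb.correction x (hle hx)⟩
  have h2 := lowestTwo_eq_zero hΩ hv hpsd (by positivity) hθ hC (hle.trans hsub) hb' h1
    (lowestTwo_eq_zero_of_rank (hpsd x₀ hx₀) hrank)
  have hle' : Metric.ball x₀ (r / 4 / 4) ⊆ Ω :=
    (Metric.ball_subset_ball (by linarith)).trans (hle.trans hsub)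
  exact ⟨r / 4 / 4, by positivity, hle', fun y hy => rank_le_two (hpsd y (hle' hy)) (h2 y hy)⟩

theorem phi_eq_zero {v : E4 → ℝ} {x : E4} (hA : (hess v x).PosSemidef)
    (hr : (hess v x).rank ≤ 2) : phi v x = 0 := by
  have h3 := sigma_eq_zero hA.1 (k := 3) (by omega)
  simp [phi, quot, h3]

theorem hess_eq_zero_of_eqOn {O : Set E4} {f : E4 → ℝ} {x : E4} (hO : IsOpen O) (hx : x ∈ O)
    (hf : ∀ y ∈ O, f y = 0) (i j : Fin 4) : hess f x i j = 0 := by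
  have hz : ∀ (k : Fin 4) (y : E4), pd k (fun _ => (0 : ℝ)) y = 0 := fun k y => by simp [pd]
  have h1 : ∀ y ∈ O, pd i f y = 0 := fun y hy => (pd_congr hO hy hf i).trans (hz i y)
  exact (pd_congr hO hx h1 j).trans (hz j x)

end ConstRank

/-- The neighbourhood is chosen so small that the Hessian has constant rank two in it; there `φ`
vanishes identically, which gives both its regularity and the differential inequality. -/
theorem theorem3p1 (M c : ℝ) (hc : 0 < c) :
    ∃ C : ℝ, 0 < C ∧
      ∀ (Ω : Set ConstRank.E4) (v : ConstRank.E4 → ℝ) (x₀ : ConstRank.E4),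
        IsOpen Ω → IsConnected Ω →
        ContDiffOn ℝ 4 v Ω →
        (∀ x ∈ Ω, (ConstRank.hess v x).PosSemidef) →
        (∀ x ∈ Ω, ConstRank.opFAt v x = 0) →
        x₀ ∈ Ω →
        (ConstRank.hess v x₀).rank = 2 →
        (∀ x ∈ Ω, 2 ≤ (ConstRank.hess v x).rank) →
        (∀ k : ℕ, k ≤ 4 → ‖iteratedFDeriv ℝ k v x₀‖ ≤ M) →
        c ≤ ConstRank.sigma 2 (ConstRank.hess v x₀) →
        ∃ O : Set ConstRank.E4, IsOpen O ∧ x₀ ∈ O ∧ O ⊆ Ω ∧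
          ContDiffOn ℝ 2 (ConstRank.phi v) O ∧
          ∀ x ∈ O,
            ∑ i, ∑ j, ConstRank.coeffF v x i j * ConstRank.hess (ConstRank.phi v) x i j
              ≤ C * (ConstRank.phi v x + ‖gradient (ConstRank.phi v) x‖) := by
  -- The constant 1 serves uniformly: only the ball depends on the solution, and on it the Hessian
  -- of `φ` is zero, so no formula for `coeffF` is needed.
  refine ⟨1, one_pos, fun Ω v x₀ hΩ _ hv hpsd heq hx₀ hrank _ _ _ => ?_⟩
  obtain ⟨r, hr, hsub, hball⟩ :=
    ConstRank.exists_ball_rank_le_two hΩ hv hpsd heq hx₀ hrank.le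
  have hphi : ∀ y ∈ Metric.ball x₀ r, ConstRank.phi v y = 0 := fun y hy =>
    ConstRank.phi_eq_zero (hpsd y (hsub hy)) (hball y hy)
  refine ⟨Metric.ball x₀ r, Metric.isOpen_ball, Metric.mem_ball_self hr, hsub,
    contDiffOn_const.congr hphi, fun x hx => ?_⟩
  have hzero := ConstRank.hess_eq_zero_of_eqOn Metric.isOpen_ball hx hphi
  simp only [hzero, mul_zero, Finset.sum_const_zero, hphi x hx, zero_add, one_mul]
  exact norm_nonneg _
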